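/- Let $k\ge 0$ be an integer. In the $k$-visibility Localization game with $m\ge 1$ cops on a finite connected graph $G$, a robber first chooses a vertex. In each round the cops choose vertices $u_1,\dots,u_m$ and receive the distance vector $(d_1,\dots,d_m)$, where $d_i$ is the distance from $u_i$ to the robber if this is at most $k$, and $d_i=\ast$ otherwise; then the robber stays or moves to a neighbouring vertex. A candidate is a vertex that the robber may occupy, immediately after a probe, consistently with all answers so far. The cops win if they have a strategy that leaves, whatever the robber does, a unique candidate after a finite number of rounds. Let $\zeta_k(G)$ be the least $m\ge1$ for which $m$ cops win. For a finite graph $G$ let $$\Phi_V(G)=\max_{0\le s\le |V(G)|}\ \min_{S\subseteq V(G),\,|S|=s}|N(S)|,$$ where $N(S)$ is the set of vertices outside $S$ with a neighbour in $S$. Let $T(h,q)$ be the complete $q$-ary tree of height $h$, that is, the rooted tree with all leaves at distance $h$ from the root in which every vertex at distance less than $h$ from the root has exactly $q$ children. (1) For all integers $h\ge 3$, $q\ge 4$ and $k\ge 0$ there is a finite tree $T$ of radius $\mathrm{rad}(T)=h(2k+1)-(k+1)$ such that $$\zeta_k(T)>\frac{\Phi_V(T(h,q))}{4(2k+1)}\ge\frac{3}{160}\,\frac{h-2}{2k+1}.$$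 If $k\ge 1$, then $T$ can be taken to be a subdivision of $T(h,q)$. (2) For every sequence of real numbers $\omega_j\to\infty$ there are finite trees $T_j$, nonnegative integers $k_j$ and real numbers $\omega'_j$ such that $\mathrm{rad}(T_j)\to\infty$, $k_j\to\infty$, $\omega'_j/\omega_j\to 1$ (so $\omega'_j\to\infty$), $k_j=\sqrt{\mathrm{rad}(T_j)}/\omega'_j$ for all $j$, and $\zeta_{k_j}(T_j)\to\infty$. -/

import Mathlib

open Filter Asymptotics

namespace VisLoc

/-! ### The `k`-visibility Localization game -/

section Game

variable {V : Type*}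

/-- The answer to a probe sent from `u` when the robber is on `x`: the distance `d(u, x)` if it is
at most `k`, and `none` (written `∗` on paper) otherwise. -/
noncomputable def probe (G : SimpleGraph V) (k : ℕ) (u x : V) : Option ℕ :=
  open Classical in if G.edist u x ≤ (k : ℕ∞) then some (G.dist u x) else none

/-- A distance vector: the answers to the probes of `m` cops. -/
abbrev DistVector (m : ℕ) : Type := Fin m → Option ℕ

/-- A strategy for `m` cops: it places the cops on vertices, given the list of the distance vectors
received so far (most recent first). -/
abbrev CopStrategy (V : Type*) (m : ℕ) : Type _ := List (DistVector m) → Fin m → V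

/-- `x t` is the position of the robber when the cops play in round `t`: in between, the robber
stays or moves to a neighbour. -/
def IsRobberPath (G : SimpleGraph V) (x : ℕ → V) : Prop :=
  ∀ t, x (t + 1) = x t ∨ G.Adj (x t) (x (t + 1))

/-- The distance vectors that the cops receive in the first `t` rounds (rounds `0, …, t - 1`, most
recent first) when they follow the strategy `σ` and the robber follows `x`. -/
noncomputable def history (G : SimpleGraph V) (k : ℕ) {m : ℕ} (σ : CopStrategy V m) (x : ℕ → V) :
    ℕ → List (DistVector m)
  | 0 => []
  | t + 1 => (fun i => probe G k (σ (history G k σ x t) i) (x t)) :: history G k σ x t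

/-- The candidates after the probes of round `t`, when the robber follows `x`: the vertices that a
robber whose moves are consistent with all answers received so far may occupy at that time. -/
def candidates (G : SimpleGraph V) (k : ℕ) {m : ℕ} (σ : CopStrategy V m) (x : ℕ → V) (t : ℕ) :
    Set V :=
  {v | ∃ y : ℕ → V, IsRobberPath G y ∧
    history G k σ y (t + 1) = history G k σ x (t + 1) ∧ y t = v}

/-- `m` cops have a strategy that, whatever the robber does, leaves a unique candidate after
finitely many rounds. -/
def CopsWin (G : SimpleGraph V) (k m : ℕ) : Prop :=
  ∃ σ : CopStrategy V m, ∀ x : ℕ → V, IsRobberPath G x →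
    ∃ t : ℕ, ∃ v : V, candidates G k σ x t = {v}

/-- The `k`-visibility localization number `ζ_k(G)`: the least positive number of cops that win. -/
noncomputable def zeta (G : SimpleGraph V) (k : ℕ) : ℕ :=
  sInf {m | 0 < m ∧ CopsWin G k m}

end Game

/-! ### Vertex isoperimetry -/

section Isoperimetry

variable {V : Type*}

/-- The border of `S`: the vertices outside `S` with a neighbour in `S`. -/
def border (G : SimpleGraph V) (S : Set V) : Set V :=
  {v | v ∉ S ∧ ∃ u ∈ S, G.Adj u v}

/-- The vertex-isoperimetric parameter at volume `s`: the least size of the border of a set of `s`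
vertices (only used for `s ≤ |V|`). -/
noncomputable def vertexIso (G : SimpleGraph V) (s : ℕ) : ℕ :=
  sInf {b | ∃ S : Finset V, S.card = s ∧ (border G (S : Set V)).ncard = b}

/-- The vertex-isoperimetric peak `Φ_V(G)` of a finite graph: the maximum over all volumes. -/
noncomputable def vertexIsoPeak (G : SimpleGraph V) : ℕ :=
  (Finset.range (Nat.card V + 1)).sup (vertexIso G)

end Isoperimetry

/-! ### Complete `q`-ary trees and subdivisions -/

/-- The complete `q`-ary tree of height `h`. Its vertices are the words of length at most `h` over
`q` letters; the root is the empty word and the children of a word `l` are the words `a :: l`. -/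
def completeTree (h q : ℕ) : SimpleGraph {l : List (Fin q) // l.length ≤ h} where
  Adj l l' := (∃ a, l'.1 = a :: l.1) ∨ (∃ a, l.1 = a :: l'.1)
  symm := ⟨fun _ _ hl => hl.symm⟩
  loopless := ⟨fun l hl => by
    rcases hl with ⟨a, ha⟩ | ⟨a, ha⟩ <;> simpa using congrArg List.length ha⟩

/-- `H` is a subdivision of `G`: it arises from `G` when the edges are replaced by internally
disjoint paths (of length at least one) with the same ends. -/
def IsSubdivision {V W : Type*} (G : SimpleGraph V) (H : SimpleGraph W) : Prop :=
  ∃ (φ : V ↪ W) (P : ∀ ⦃u v : V⦄, G.Adj u v → H.Walk (φ u) (φ v)),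
    (∀ ⦃u v : V⦄ (e : G.Adj u v), (P e).IsPath) ∧
    (∀ ⦃u v : V⦄ (e : G.Adj u v), P e.symm = (P e).reverse) ∧
    (∀ ⦃u v : V⦄ (e : G.Adj u v) (x : V), φ x ∈ (P e).support → x = u ∨ x = v) ∧
    (∀ ⦃u v u' v' : V⦄ (e : G.Adj u v) (e' : G.Adj u' v') (w : W),
      w ∈ (P e).support → w ∈ (P e').support → w ∉ Set.range φ → s(u, v) = s(u', v')) ∧
    (∀ w : W, w ∈ Set.range φ ∨ ∃ (u v : V) (e : G.Adj u v), w ∈ (P e).support) ∧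
    (∀ f ∈ H.edgeSet, ∃ (u v : V) (e : G.Adj u v), f ∈ (P e).edges)

end VisLoc

/-!
The tree is obtained from `completeTree (d + 1) q`, where `h = d + 1`, by replacing the edges by
paths of length `2 * k + 1`, except that the edges at the leaves become paths of length `k`. Its
radius is `d * (2 * k + 1) + k`.

*The robber's side.* A cop who sees up to distance `k` disturbs at most one of the vertices of
`completeTree d q`, which lie at mutual distance at least `2 * k + 1`, and the paths at this vertex
(`Blowup.anchor`). So during `2 * k + 1` rounds, `m` cops disturb at most `M = m * (2 * k + 1)` of
these vertices, and in the same time the robber can walk unseen from an undisturbed vertex to an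
undisturbed neighbour. If every set of `s` vertices has at least `2 * M` border vertices, then
at least `s + M` vertices remain possible after every such block of rounds
(`not_copsWin_of_vertexIso`). By compactness, some robber is never seen, and for him there are
always at least two candidates. Hence `2 * M` exceeds the isoperimetric peak of
`completeTree d q` if `m` cops win. This peak is at least the peak of `completeTree (d + 1) q`
minus one, because a set of prescribed size can be composed of full branches at the root and an
optimal set in one more branch (`vertexIsoPeak_completeTree_succ_le`). As `M` is positive,
`4 * M` exceeds the peak of `completeTree (d + 1) q`.

*The peak.* The size of a vertex set is determined by whether it contains the root and by the
following data on its border: for each border vertex, its depth, the number of its children in the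
set, and whether its parent is in the set (`sum_words_eq_sum_border`). Counting these data
(`exists_finset_forall_sum_mem`), sets with at most `b` border vertices have at most
`2 ^ (h + 2) * (4 * (q + 1)) ^ b` different sizes (`card_words_lt`). For `b` equal to the peak, all
sizes occur, and there are more than `q ^ h` of them, so `b` is at least linear in `h`.

For the second part, `q = 4`, and `h` is about `k * ω ^ 2 / 2`, so that the square root of the
radius is about `k * ω`.
-/

namespace VisLoc

/-! ### Sums with few terms -/

/-- If a summand of level `i` has at most `K` possible values, then sums of at most `b` summands
whose levels are below `j` take at most `2 ^ j * (2 * K) ^ b` values. The bound solves the recursion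
obtained by splitting off one summand of the top level, if there is any. -/
theorem exists_finset_forall_sum_mem {ι : Type*} [DecidableEq ι] (lev : ι → ℕ) (D : ℕ → Finset ℤ)
    {K : ℕ} (hK : 1 ≤ K) (hD : ∀ i, (D i).card ≤ K) (j b : ℕ) :
    ∃ X : Finset ℤ, X.card ≤ 2 ^ j * (2 * K) ^ b ∧
      ∀ (B : Finset ι) (f : ι → ℤ), B.card ≤ b → (∀ v ∈ B, lev v < j) →
        (∀ v ∈ B, f v ∈ D (lev v)) → ∑ v ∈ B, f v ∈ X := by
  induction j generalizing b with
  | zero =>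
    refine ⟨{0}, ?_, fun B f _ hB _ => ?_⟩
    · simpa using Nat.one_le_pow _ _ (by omega)
    · rw [Finset.eq_empty_of_forall_notMem fun v hv => absurd (hB v hv) (Nat.not_lt_zero _)]
      simp
  | succ j ihj =>
    induction b with
    | zero =>
      refine ⟨{0}, ?_, fun B f hb _ _ => ?_⟩
      · simpa using Nat.one_le_pow _ _ (by omega)
      · rw [Finset.card_eq_zero.1 (Nat.le_zero.1 hb)]
        simp
    | succ b ihb =>
      obtain ⟨X, hX, hXmem⟩ := ihj (b + 1)
      obtain ⟨Y, hY, hYmem⟩ := ihb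
      refine ⟨X ∪ Finset.image₂ (· + ·) (D j) Y, ?_, fun B f hb hB hf => ?_⟩
      · calc (X ∪ Finset.image₂ (· + ·) (D j) Y).card
            ≤ X.card + (D j).card * Y.card :=
              (Finset.card_union_le _ _).trans
                (Nat.add_le_add_left (Finset.card_image₂_le _ _ _) _)
          _ ≤ 2 ^ j * (2 * K) ^ (b + 1) + K * (2 ^ (j + 1) * (2 * K) ^ b) :=
              Nat.add_le_add hX (Nat.mul_le_mul (hD j) hY)
          _ = 2 ^ (j + 1) * (2 * K) ^ (b + 1) := by ring
      · by_cases hv : ∃ v ∈ B, lev v = j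
        · obtain ⟨v, hvB, rfl⟩ := hv
          refine Finset.mem_union_right _ ?_
          rw [← Finset.add_sum_erase B f hvB]
          refine Finset.mem_image₂_of_mem (hf v hvB) (hYmem _ f ?_ ?_ ?_)
          · rw [Finset.card_erase_of_mem hvB]; omega
          · exact fun w hw => hB w (Finset.mem_of_mem_erase hw)
          · exact fun w hw => hf w (Finset.mem_of_mem_erase hw)
        · push Not at hv
          exact Finset.mem_union_left _ (hXmem B f hb
            (fun w hw => by have := hB w hw; have := hv w hw; omega) hf)

/-! ### Words and the complete tree -/

/-- The words of length at most `h`, that is, the vertices of `completeTree h q`. -/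
abbrev Word (h q : ℕ) : Type := {l : List (Fin q) // l.length ≤ h}

instance (h q : ℕ) : Finite (Word h q) := List.finite_length_le (Fin q) h

/-- The words of length at most `h`, as a finite set of lists. -/
noncomputable def words (h q : ℕ) : Finset (List (Fin q)) :=
  (List.finite_length_le (Fin q) h).toFinset

@[simp] theorem mem_words {h q : ℕ} {l : List (Fin q)} : l ∈ words h q ↔ l.length ≤ h := by
  simp [words]

theorem card_words (h q : ℕ) : (words h q).card = Nat.card (Word h q) :=
  (Nat.card_eq_card_finite_toFinset (List.finite_length_le (Fin q) h)).symm

theorem pow_le_card_words (h q : ℕ) : q ^ h ≤ (words h q).card := by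
  have hv : Fintype.card (List.Vector (Fin q) h) = q ^ h := by rw [card_vector, Fintype.card_fin]
  rw [← hv, ← Finset.card_univ]
  refine Finset.card_le_card_of_injOn (fun v => v.1) (fun v _ => ?_)
    (fun v _ w _ hvw => Subtype.ext hvw)
  simp

/-- The number of words of length at most `h` that extend a given word of length `i`. -/
noncomputable def extensions (h q i : ℕ) : ℕ :=
  ((words h q).filter fun u => u.length + i ≤ h).card

theorem card_filter_suffix {h q : ℕ} (v : List (Fin q)) :
    ((words h q).filter fun w => v <:+ w).card = extensions h q v.length := by
  symm
  refine Finset.card_bij (fun u _ => u ++ v) ?_ ?_ ?_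
  · intro u hu
    simp at hu ⊢
    omega
  · intro u _ u' _ huu
    simpa using huu
  · intro w hw
    simp only [Finset.mem_filter, mem_words] at hw
    obtain ⟨hw, u, rfl⟩ := hw
    refine ⟨u, ?_, rfl⟩
    simp at hw ⊢
    omega

/-- The difference between the value of `g` at a vertex and its value at the parent; the parent of
the root counts as having value `0`. -/
def increment {q : ℕ} (g : List (Fin q) → ℤ) : List (Fin q) → ℤ
  | [] => g []
  | a :: l => g (a :: l) - g l

theorem sum_increment_suffix {h q : ℕ} (g : List (Fin q) → ℤ) (w : List (Fin q))
    (hw : w ∈ words h q) :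
    ∑ v ∈ (words h q).filter (fun v => v <:+ w), increment g v = g w := by
  induction w with
  | nil =>
    have : (words h q).filter (fun v => v <:+ []) = {[]} := by
      ext v; simp +contextual
    rw [this, Finset.sum_singleton, increment]
  | cons a l ih =>
    have hl : l ∈ words h q := by simp at hw ⊢; omega
    have : (words h q).filter (fun v => v <:+ a :: l) =
        insert (a :: l) ((words h q).filter (fun v => v <:+ l)) := by
      ext v
      simp only [Finset.mem_filter, Finset.mem_insert, List.suffix_cons_iff]
      constructor
      · tauto
      · rintro (rfl | h1)
        · exact ⟨hw, Or.inl rfl⟩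
        · exact ⟨h1.1, Or.inr h1.2⟩
    rw [this, Finset.sum_insert, ih hl, increment, sub_add_cancel]
    simp only [Finset.mem_filter, not_and]
    intro _ hs
    simpa using hs.length_le

/-- Summation by parts along the tree: every increment counts once for each vertex of the subtree in
which it takes effect. -/
theorem sum_words_eq_sum_increment {h q : ℕ} (g : List (Fin q) → ℤ) :
    ∑ w ∈ words h q, g w = ∑ v ∈ words h q, increment g v * extensions h q v.length := by
  classical
  rw [Finset.sum_congr rfl fun w hw => (sum_increment_suffix g w hw).symm]
  simp_rw [Finset.sum_filter]
  rw [Finset.sum_comm]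
  refine Finset.sum_congr rfl fun v _ => ?_
  rw [← Finset.sum_filter, Finset.sum_const, card_filter_suffix, nsmul_eq_mul, mul_comm]

/-- The value at the parent, which is `0` for the root. -/
def parentValue {q : ℕ} (g : List (Fin q) → ℤ) : List (Fin q) → ℤ
  | [] => 0
  | _ :: l => g l

/-- The increments of the indicator function of `S` are supported on the border `B` and on the
children of border vertices: a border vertex lies outside `S`, so it contributes minus the value of
its parent, and a vertex of `S` whose parent is outside `S` has its parent on the border. -/
theorem increment_eq {h q : ℕ} (g : List (Fin q) → ℤ) (B : Finset (List (Fin q)))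
    (hB : ∀ v ∈ B, g v = 0)
    (hdown : ∀ a l, a :: l ∈ words h q → a :: l ∉ B → g l ≠ 0 → g (a :: l) = g l)
    (hup : ∀ a l, l ∉ B → g (a :: l) ≠ 0 → g l = g (a :: l))
    {v : List (Fin q)} (hvw : v ∈ words h q) :
    increment g v = (if v = [] then g [] else 0) - (if v ∈ B then parentValue g v else 0) +
      ∑ u ∈ B, ∑ a : Fin q, if v = a :: u then g v else 0 := by
  cases v with
  | nil => simp [increment, parentValue]
  | cons a l =>
    have h1 : ∑ u ∈ B, ∑ b : Fin q, (if a :: l = b :: u then g (a :: l) else 0) =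
        if l ∈ B then g (a :: l) else 0 := by
      rw [← Finset.sum_ite_eq B l fun _ => g (a :: l)]
      refine Finset.sum_congr rfl fun u _ => ?_
      by_cases hu : l = u
      · subst hu; simp
      · simp [hu]
    rw [h1]
    by_cases hv : a :: l ∈ B
    · have := hB _ hv
      simp [increment, parentValue, hv, this]
    · by_cases hl : l ∈ B
      · simp [increment, hv, hl, hB l hl]
      · have h2 := hdown a l hvw hv
        have h3 := hup a l hl
        simp only [increment, hv, hl, if_false, reduceCtorEq]
        by_cases h4 : g l = 0
        · by_cases h5 : g (a :: l) = 0
          · simp [h4, h5]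
          · exact absurd ((h3 h5).symm.trans h4) h5
        · simp [h2 h4]

/-- The size of a vertex set of the complete tree in terms of its border: each border vertex `v`
contributes the sizes of the subtrees at its children in the set, minus the size of the subtree
at `v` if its parent is in the set. -/
theorem sum_words_eq_sum_border {h q : ℕ} (g : List (Fin q) → ℤ) (B : Finset (List (Fin q)))
    (hBw : B ⊆ words h q) (hg : ∀ v, v ∉ words h q → g v = 0)
    (hB : ∀ v ∈ B, g v = 0)
    (hdown : ∀ a l, a :: l ∈ words h q → a :: l ∉ B → g l ≠ 0 → g (a :: l) = g l)
    (hup : ∀ a l, l ∉ B → g (a :: l) ≠ 0 → g l = g (a :: l)) :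
    ∑ w ∈ words h q, g w = g [] * extensions h q 0 +
      ∑ v ∈ B, ((∑ a : Fin q, g (a :: v)) * extensions h q (v.length + 1) -
        parentValue g v * extensions h q v.length) := by
  have hroot : ∑ v ∈ words h q, (if v = [] then g [] else 0) * (extensions h q v.length : ℤ) =
      g [] * extensions h q 0 := by
    simp [ite_mul]
  have hborder : ∑ v ∈ words h q,
      (if v ∈ B then parentValue g v else 0) * (extensions h q v.length : ℤ) =
        ∑ v ∈ B, parentValue g v * extensions h q v.length := by
    simp_rw [ite_mul, zero_mul]
    rw [← Finset.sum_filter, Finset.filter_mem_eq_inter, Finset.inter_eq_right.2 hBw]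
  have hchild : ∑ v ∈ words h q,
      (∑ u ∈ B, ∑ a : Fin q, if v = a :: u then g v else 0) * (extensions h q v.length : ℤ) =
        ∑ u ∈ B, (∑ a : Fin q, g (a :: u)) * extensions h q (u.length + 1) := by
    simp_rw [Finset.sum_mul, ite_mul, zero_mul]
    rw [Finset.sum_comm]
    refine Finset.sum_congr rfl fun u _ => ?_
    rw [Finset.sum_comm]
    refine Finset.sum_congr rfl fun a _ => ?_
    rw [Finset.sum_ite_eq']
    split_ifs with hau
    · simp
    · rw [hg _ hau, zero_mul]
  rw [sum_words_eq_sum_increment, Finset.sum_congr rfl fun v hv => by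
    rw [increment_eq g B hB hdown hup hv, add_mul, sub_mul], Finset.sum_add_distrib,
    Finset.sum_sub_distrib, hroot, hborder, hchild, Finset.sum_sub_distrib]
  ring

/-! ### The isoperimetric peak of the complete tree -/

section Peak

variable {V : Type*} (G : SimpleGraph V)

theorem vertexIso_le {S : Finset V} : vertexIso G S.card ≤ (border G (S : Set V)).ncard :=
  Nat.sInf_le ⟨S, rfl, rfl⟩

theorem exists_border_ncard_eq_vertexIso [Finite V] {s : ℕ} (hs : s ≤ Nat.card V) :
    ∃ S : Finset V, S.card = s ∧ (border G (S : Set V)).ncard = vertexIso G s := by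
  have := Fintype.ofFinite V
  refine Nat.sInf_mem
    (s := {b | ∃ S : Finset V, S.card = s ∧ (border G (S : Set V)).ncard = b}) ?_
  obtain ⟨S, -, hS⟩ := Finset.exists_subset_card_eq
    (s := (Finset.univ : Finset V)) (n := s) (by simpa using hs)
  exact ⟨_, S, hS, rfl⟩

theorem vertexIso_le_peak {s : ℕ} (hs : s ≤ Nat.card V) : vertexIso G s ≤ vertexIsoPeak G :=
  Finset.le_sup (Finset.mem_range.2 (Nat.lt_succ_of_le hs))

theorem exists_vertexIso_eq_peak : ∃ s ≤ Nat.card V, vertexIso G s = vertexIsoPeak G := by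
  obtain ⟨s, hs, h⟩ := Finset.exists_mem_eq_sup (Finset.range (Nat.card V + 1))
    ⟨0, by simp⟩ (vertexIso G)
  exact ⟨s, Nat.lt_succ_iff.1 (Finset.mem_range.1 hs), h.symm⟩

end Peak

/-- Sets with at most `b` border vertices attain at most `2 ^ (h + 2) * (4 * (q + 1)) ^ b` different
sizes, and if the peak is at most `b`, they attain every size. -/
theorem card_words_lt {h q b : ℕ} (hb : vertexIsoPeak (completeTree h q) ≤ b) :
    (words h q).card < 2 ^ (h + 2) * (4 * (q + 1)) ^ b := by
  classical
  -- the possible contributions of a border vertex of depth `i`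
  let D : ℕ → Finset ℤ := fun i => Finset.image₂
    (fun c d : ℕ => (c : ℤ) * extensions h q (i + 1) - d * extensions h q i)
    (Finset.range (q + 1)) (Finset.range 2)
  have hD : ∀ i, (D i).card ≤ 2 * (q + 1) := fun i =>
    (Finset.card_image₂_le _ _ _).trans (by simp [mul_comm])
  obtain ⟨X, hXcard, hX⟩ := exists_finset_forall_sum_mem
    (List.length : List (Fin q) → ℕ) D (by omega) hD (h + 1) b
  have hmem : (Finset.range ((words h q).card + 1)).image (fun s : ℕ => (s : ℤ)) ⊆
      X ∪ X.image fun x => extensions h q 0 + x := by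
    intro z hz
    simp only [Finset.mem_image, Finset.mem_range] at hz
    obtain ⟨s, hs, rfl⟩ := hz
    have hs' : s ≤ Nat.card (Word h q) := by rw [← card_words]; omega
    obtain ⟨S, rfl, hSb⟩ := exists_border_ncard_eq_vertexIso (completeTree h q) hs'
    let S' : Finset (List (Fin q)) := S.map (Function.Embedding.subtype _)
    let B : Finset (List (Fin q)) :=
      ((Set.toFinite (border (completeTree h q) (S : Set (Word h q)))).toFinset).map
        (Function.Embedding.subtype _)
    let g : List (Fin q) → ℤ := fun l => if l ∈ S' then 1 else 0
    have hS' : ∀ l, l ∈ S' ↔ ∃ hl : l.length ≤ h, (⟨l, hl⟩ : Word h q) ∈ S := by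
      intro l; simp [S']
    have hB' : ∀ l, l ∈ B ↔ ∃ hl : l.length ≤ h,
        (⟨l, hl⟩ : Word h q) ∈ border (completeTree h q) (S : Set (Word h q)) := by
      intro l; simp [B]
    have hS'w : S' ⊆ words h q := fun l hl => mem_words.2 ((hS' l).1 hl).1
    have hg0 : ∀ l, g l ≠ 0 ↔ l ∈ S' := by intro l; simp [g]
    have hg1 : ∀ l, l ∈ S' → g l = 1 := by intro l hl; simp [g, hl]
    have hsum : ∑ w ∈ words h q, g w = S.card := by
      simp only [g, Finset.sum_ite_mem, Finset.inter_eq_right.2 hS'w, Finset.sum_const]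
      simp [S']
    have hBcard : B.card ≤ b := by
      rw [Finset.card_map, ← Set.ncard_eq_toFinset_card, hSb]
      exact (vertexIso_le_peak _ hs').trans hb
    have key := sum_words_eq_sum_border (h := h) g B
      (fun l hl => mem_words.2 ((hB' l).1 hl).1)
      (fun v hv => by
        by_contra hne
        exact hv (hS'w ((hg0 v).1 hne)))
      (fun v hv => by
        by_contra hne
        obtain ⟨hl, hv1, -⟩ := (hB' v).1 hv
        exact hv1 ((hS' v).1 ((hg0 v).1 hne)).2)
      (fun a l hw hv hl => by
        obtain ⟨hlh, hlS⟩ := (hS' l).1 ((hg0 l).1 hl)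
        rw [hg1 l ((hg0 l).1 hl), hg1]
        by_contra hne
        exact hv ((hB' _).2 ⟨mem_words.1 hw, fun hS => hne ((hS' _).2 ⟨_, hS⟩),
          ⟨l, hlh⟩, hlS, Or.inl ⟨a, rfl⟩⟩))
      (fun a l hl hv => by
        obtain ⟨hvh, hvS⟩ := (hS' (a :: l)).1 ((hg0 _).1 hv)
        rw [hg1 (a :: l) ((hg0 _).1 hv), hg1]
        by_contra hne
        exact hl ((hB' _).2 ⟨(Nat.le_succ _).trans hvh, fun hS => hne ((hS' _).2 ⟨_, hS⟩),
          ⟨a :: l, hvh⟩, hvS, Or.inr ⟨a, rfl⟩⟩))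
    have hXg := hX B (fun v => (∑ a : Fin q, g (a :: v)) * extensions h q (v.length + 1) -
        parentValue g v * extensions h q v.length) hBcard
      (fun v hv => Nat.lt_succ_of_le ((hB' v).1 hv).1)
      (fun v _ => by
        refine Finset.mem_image₂.2 ⟨(Finset.univ.filter fun a : Fin q => a :: v ∈ S').card, ?_,
          (parentValue g v).toNat, ?_, ?_⟩
        · rw [Finset.mem_range, Nat.lt_succ_iff]
          simpa using Finset.card_le_univ (Finset.univ.filter fun a : Fin q => a :: v ∈ S')
        · cases v with
          | nil => simp [parentValue]
          | cons a l => simp only [parentValue, g]; split_ifs <;> simp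
        · have h1 : 0 ≤ parentValue g v := by
            cases v with
            | nil => simp [parentValue]
            | cons a l => simp only [parentValue, g]; split_ifs <;> simp
          rw [Int.toNat_of_nonneg h1]
          simp [g])
    rw [hsum] at key
    rw [key]
    by_cases hnil : [] ∈ S'
    · rw [hg1 _ hnil, one_mul]
      exact Finset.mem_union_right _ (Finset.mem_image_of_mem _ hXg)
    · rw [show g [] = 0 by simp [g, hnil], zero_mul, zero_add]
      exact Finset.mem_union_left _ hXg
  have h1 := Finset.card_le_card hmem
  rw [Finset.card_image_of_injective _ Nat.cast_injective, Finset.card_range] at h1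
  have h2 := (Finset.card_union_le X (X.image fun x => extensions h q 0 + x)).trans
    (Nat.add_le_add_left Finset.card_image_le _)
  calc (words h q).card < X.card + X.card := h1.trans h2
    _ ≤ 2 * (2 ^ (h + 1) * (2 * (2 * (q + 1))) ^ b) := by omega
    _ = 2 ^ (h + 2) * (4 * (q + 1)) ^ b := by ring

theorem three_mul_le_vertexIsoPeak {h q : ℕ} (hq : 4 ≤ q) :
    3 * (h - 2) ≤ 40 * vertexIsoPeak (completeTree h q) := by
  set b := vertexIsoPeak (completeTree h q) with hb
  have h1 : q ^ h < 2 ^ (h + 2) * (4 * (q + 1)) ^ b :=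
    (pow_le_card_words h q).trans_lt (card_words_lt hb.ge)
  have h2 : 4 * (q + 1) ≤ q ^ 3 := by nlinarith [Nat.mul_le_mul hq hq]
  have h3 : (2 ^ (h + 2)) ^ 2 ≤ q ^ (h + 2) := by
    rw [pow_right_comm]
    exact Nat.pow_le_pow_left hq _
  have h4 : q ^ (2 * h) < q ^ (h + 2 + 6 * b) := by
    calc q ^ (2 * h) = (q ^ h) ^ 2 := by rw [← pow_mul, mul_comm]
      _ < (2 ^ (h + 2) * (4 * (q + 1)) ^ b) ^ 2 := Nat.pow_lt_pow_left h1 (by norm_num)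
      _ = (2 ^ (h + 2)) ^ 2 * ((4 * (q + 1)) ^ b) ^ 2 := mul_pow _ _ _
      _ ≤ q ^ (h + 2) * ((q ^ 3) ^ b) ^ 2 :=
        Nat.mul_le_mul h3 (Nat.pow_le_pow_left (Nat.pow_le_pow_left h2 _) _)
      _ = q ^ (h + 2 + 6 * b) := by ring
  have h5 := (Nat.pow_lt_pow_iff_right (by omega : 1 < q)).1 h4
  omega

/-- A set of prescribed size in the tree of height `h + 1` may be taken as the union of some full
branches at the root and an optimal part of one more branch. -/
theorem vertexIsoPeak_completeTree_succ_le (h q : ℕ) :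
    vertexIsoPeak (completeTree (h + 1) q) ≤ vertexIsoPeak (completeTree h q) + 1 := by
  classical
  have := Fintype.ofFinite (Word h q)
  obtain ⟨s, hs, hpeak⟩ := exists_vertexIso_eq_peak (completeTree (h + 1) q)
  rw [← hpeak]
  set N := Nat.card (Word h q) with hN
  have hNpos : 0 < N := by
    have : Nonempty (Word h q) := ⟨⟨[], Nat.zero_le _⟩⟩
    exact Nat.card_pos
  -- the copy of a word in the branch `a`, and the vertex set of the whole tree
  let f : Word h q × Fin q ↪ Word (h + 1) q :=
    ⟨fun p => ⟨p.1.1 ++ [p.2], by simpa using p.1.2⟩, fun p p' hpp => by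
      have := congrArg Subtype.val hpp
      simp only [List.append_singleton_inj] at this
      exact Prod.ext (Subtype.ext this.1) this.2⟩
  have hf : ∀ w : Word (h + 1) q, w.1 ≠ [] → ∃ p, f p = w := by
    rintro ⟨w, hw⟩ hne
    refine ⟨⟨⟨w.dropLast, by simp; omega⟩, w.getLast hne⟩, Subtype.ext ?_⟩
    exact List.dropLast_append_getLast hne
  have hcard : Nat.card (Word (h + 1) q) ≤ q * N + 1 := by
    have h1 : Function.Surjective fun o : Option (Word h q × Fin q) =>
        o.elim (⟨[], Nat.zero_le _⟩ : Word (h + 1) q) f := by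
      intro w
      by_cases hw : w.1 = []
      · exact ⟨none, Subtype.ext hw.symm⟩
      · obtain ⟨p, hp⟩ := hf w hw
        exact ⟨some p, hp⟩
    refine (Nat.card_le_card_of_surjective _ h1).trans ?_
    rw [Finite.card_option, Nat.card_prod, Nat.card_fin, mul_comm]
  by_cases hsq : s ≤ q * N
  · have hmod : s % N ≤ N := (Nat.mod_lt _ hNpos).le
    obtain ⟨S, hScard, hSborder⟩ := exists_border_ncard_eq_vertexIso (completeTree h q) hmod
    let A : Finset (Word h q × Fin q) :=
      (Finset.univ ×ˢ Finset.univ.filter fun a : Fin q => a.1 < s / N) ∪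
        (S ×ˢ Finset.univ.filter fun a : Fin q => a.1 = s / N)
    have hmemA : ∀ u a, (u, a) ∈ A ↔ a.1 < s / N ∨ (u ∈ S ∧ a.1 = s / N) := by
      intro u a; simp [A]
    have hdiv : s / N ≤ q := by
      rw [mul_comm] at hsq
      exact Nat.div_le_of_le_mul hsq
    have hAcard : A.card = s := by
      rw [Finset.card_union_of_disjoint, Finset.card_product, Finset.card_product, hScard,
        Finset.card_univ, ← Nat.card_eq_fintype_card, ← hN]
      · have h1 : (Finset.univ.filter fun a : Fin q => a.1 < s / N).card = s / N := by
          rw [Fin.card_filter_val_lt, min_eq_right hdiv]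
        rw [h1]
        rcases hdiv.lt_or_eq with hlt | heq
        · have h2 : (Finset.univ.filter fun a : Fin q => a.1 = s / N) = {⟨s / N, hlt⟩} := by
            ext a; simp [Fin.ext_iff]
          rw [h2, Finset.card_singleton, mul_one]
          exact Nat.div_add_mod s N
        · have h3 : s % N = 0 := by
            have h4 := Nat.div_add_mod s N
            rw [heq, mul_comm] at h4
            omega
          rw [h3, zero_mul, add_zero]
          have h4 := Nat.div_add_mod s N
          rwa [h3, add_zero] at h4
      · rw [Finset.disjoint_left]
        rintro ⟨u, a⟩ h1 h2
        simp at h1 h2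
        omega
    have hsub : border (completeTree (h + 1) q) ((A.map f : Finset _) : Set (Word (h + 1) q)) ⊆
        insert ⟨[], Nat.zero_le _⟩ ((fun w : Word h q =>
          (⟨w.1 ++ (if hq : s / N < q then [⟨s / N, hq⟩] else []), by
            split_ifs <;> simp <;> have := w.2 <;> omega⟩ : Word (h + 1) q)) ''
          border (completeTree h q) (S : Set (Word h q))) := by
      rintro v ⟨hv, u, hu, huv⟩
      by_cases hvnil : v.1 = []
      · exact Or.inl (Subtype.ext hvnil)
      right
      obtain ⟨⟨v, a⟩, rfl⟩ := hf v hvnil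
      obtain ⟨⟨u, a'⟩, huA, rfl⟩ := Finset.mem_map.1 (Finset.mem_coe.1 hu)
      have hvA : (v, a) ∉ A := fun hA => hv (Finset.mem_coe.2 (Finset.mem_map_of_mem f hA))
      have haa : a = a' ∧ (completeTree h q).Adj u v := by
        rcases huv with ⟨c, hc⟩ | ⟨c, hc⟩
        · change v.1 ++ [a] = c :: (u.1 ++ [a']) at hc
          rw [← List.cons_append, List.append_singleton_inj] at hc
          exact ⟨hc.2, Or.inl ⟨c, hc.1⟩⟩
        · change u.1 ++ [a'] = c :: (v.1 ++ [a]) at hc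
          rw [← List.cons_append, List.append_singleton_inj] at hc
          exact ⟨hc.2.symm, Or.inr ⟨c, hc.1⟩⟩
      obtain ⟨rfl, hadj⟩ := haa
      rw [hmemA] at huA hvA
      push Not at hvA
      have ha : a.1 = s / N := by rcases huA with h1 | h1 <;> omega
      have huS : u ∈ S := by rcases huA with h1 | h1; omega; exact h1.1
      have hvS : v ∉ S := fun h1 => hvA.2 h1 ha
      refine ⟨v, ⟨hvS, u, huS, hadj⟩, Subtype.ext ?_⟩
      have : s / N < q := ha ▸ a.2
      simp only [this, dif_pos]
      change v.1 ++ [_] = v.1 ++ [a]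
      rw [List.append_cancel_left_eq, List.singleton_inj]
      exact Fin.ext ha.symm
    calc vertexIso (completeTree (h + 1) q) s
        = vertexIso (completeTree (h + 1) q) (A.map f).card := by rw [Finset.card_map, hAcard]
      _ ≤ _ := vertexIso_le _
      _ ≤ _ := Set.ncard_le_ncard hsub (Set.toFinite _)
      _ ≤ _ := Set.ncard_insert_le _ _
      _ ≤ (border (completeTree h q) (S : Set (Word h q))).ncard + 1 :=
        Nat.add_le_add_right (Set.ncard_image_le (Set.toFinite _)) 1
      _ ≤ _ := Nat.add_le_add_right (hSborder.le.trans (vertexIso_le_peak _ hmod)) 1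
  · have := Fintype.ofFinite (Word (h + 1) q)
    have h1 : s = (Finset.univ : Finset (Word (h + 1) q)).card := by
      have hs' : s ≤ Nat.card (Word (h + 1) q) := hs
      rw [Finset.card_univ, ← Nat.card_eq_fintype_card]
      omega
    have h2 : border (completeTree (h + 1) q)
        ((Finset.univ : Finset (Word (h + 1) q)) : Set (Word (h + 1) q)) = ∅ := by
      ext v; simp [border]
    have h3 := vertexIso_le (completeTree (h + 1) q) (S := Finset.univ)
    rw [h2, Set.ncard_empty, ← h1] at h3
    omega

/-- A leaf has only one neighbour. -/
theorem vertexIso_completeTree_one_le {h q : ℕ} (hq : 0 < q) :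
    vertexIso (completeTree h q) 1 ≤ 1 := by
  let v : Word h q := ⟨List.replicate h ⟨0, hq⟩, by simp⟩
  have h1 := vertexIso_le (completeTree h q) (S := {v})
  rw [Finset.card_singleton] at h1
  refine h1.trans ((Set.ncard_le_one_iff (Set.toFinite _)).2 ?_)
  have h2 : ∀ w, w ∈ border (completeTree h q) (({v} : Finset (Word h q)) : Set (Word h q)) →
      w.1 = v.1.tail := by
    rintro w ⟨-, u, hu, hadj⟩
    obtain rfl : u = v := by simpa using hu
    rcases hadj with ⟨a, ha⟩ | ⟨a, ha⟩
    · have h3 := w.2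
      rw [ha] at h3
      simp [v] at h3
    · rw [ha, List.tail_cons]
  exact fun {a b} ha hb => Subtype.ext ((h2 a ha).trans (h2 b hb).symm)

theorem vertexIso_zero {V : Type*} (G : SimpleGraph V) : vertexIso G 0 = 0 := by
  have h1 := vertexIso_le G (S := ∅)
  simpa [border] using h1

/-! ### A robber who is never seen -/

section Game

variable {W : Type*} (T : SimpleGraph W) (k : ℕ) {m : ℕ}

/-- The positions of the cops in round `t` if none of them has seen the robber before. -/
def blindProbe (σ : CopStrategy W m) (t : ℕ) : Fin m → W :=
  σ (List.replicate t fun _ => none)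

/-- No cop who follows `σ` sees a robber on `v` in round `t`, if the robber was not seen before. -/
def UnseenAt (σ : CopStrategy W m) (t : ℕ) (v : W) : Prop :=
  ∀ i, ¬ T.edist (blindProbe σ t i) v ≤ (k : ℕ∞)

/-- A robber can occupy `v` in round `t` without having been seen in the rounds `0, …, t`. -/
def UnseenReach (σ : CopStrategy W m) (t : ℕ) (v : W) : Prop :=
  ∃ y, IsRobberPath T y ∧ (∀ τ ≤ t, UnseenAt T k σ τ (y τ)) ∧ y t = v

variable {T k} {σ : CopStrategy W m}

theorem history_of_unseen {y : ℕ → W} {t : ℕ} (hy : ∀ τ < t, UnseenAt T k σ τ (y τ)) :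
    history T k σ y t = List.replicate t fun _ => none := by
  induction t with
  | zero => rfl
  | succ t ih =>
    rw [history, ih fun τ hτ => hy τ (by omega), List.replicate_succ]
    congr 1
    funext i
    exact if_neg (hy t (by omega) i)

theorem UnseenReach.zero {v : W} (hv : UnseenAt T k σ 0 v) : UnseenReach T k σ 0 v :=
  ⟨fun _ => v, fun _ => Or.inl rfl, fun τ hτ => by rwa [Nat.le_zero.1 hτ], rfl⟩

theorem UnseenReach.succ {t : ℕ} {v w : W} (hv : UnseenReach T k σ t v) (hvw : w = v ∨ T.Adj v w)
    (hw : UnseenAt T k σ (t + 1) w) : UnseenReach T k σ (t + 1) w := by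
  obtain ⟨y, hy, hun, rfl⟩ := hv
  refine ⟨fun τ => if τ ≤ t then y τ else w, fun τ => ?_, fun τ hτ => ?_, by simp⟩
  · rcases lt_trichotomy τ t with h | rfl | h
    · simpa [h.le, Nat.succ_le_of_lt h] using hy τ
    · simpa using hvw
    · exact Or.inl (by simp [show ¬ τ ≤ t by omega, show ¬ τ + 1 ≤ t by omega])
  · rcases hτ.lt_or_eq with h | rfl
    · simpa [Nat.le_of_lt_succ h] using hun τ (Nat.le_of_lt_succ h)
    · simpa using hw

theorem UnseenReach.of_walk {t : ℕ} {v w : W} (hv : UnseenReach T k σ t v) (p : T.Walk v w)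
    (n : ℕ) (hp : ∀ j, 1 ≤ j → j ≤ n → UnseenAt T k σ (t + j) (p.getVert j)) :
    UnseenReach T k σ (t + n) (p.getVert n) := by
  induction n with
  | zero => simpa using hv
  | succ n ih =>
    refine (ih fun j h1 h2 => hp j h1 (by omega)).succ ?_ (hp (n + 1) (by omega) le_rfl)
    by_cases hn : n < p.length
    · exact Or.inr (p.adj_getVert_succ hn)
    · left
      rw [p.getVert_of_length_le (by omega), p.getVert_of_length_le (by omega)]

/-- In a finite graph, a robber who can stay unseen for arbitrarily long can stay unseen forever,
by compactness of the space of sequences of vertices. -/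
theorem exists_unseen_forever [Finite W] (h : ∀ t, ∃ v, UnseenReach T k σ t v) :
    ∃ y, IsRobberPath T y ∧ ∀ t, UnseenAt T k σ t (y t) := by
  let _ : TopologicalSpace W := ⊥
  have _ : DiscreteTopology W := ⟨rfl⟩
  let C : ℕ → Set (ℕ → W) := fun t => {y | IsRobberPath T y ∧ ∀ τ ≤ t, UnseenAt T k σ τ (y τ)}
  have hclosed : ∀ t, IsClosed (C t) := by
    intro t
    have h1 : IsClosed {y : ℕ → W | IsRobberPath T y} := by
      simp only [IsRobberPath, Set.ofPred_forall]
      refine isClosed_iInter fun τ => ?_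
      exact (isClosed_discrete {p : W × W | p.2 = p.1 ∨ T.Adj p.1 p.2}).preimage
        (f := fun y : ℕ → W => (y τ, y (τ + 1)))
        ((continuous_apply τ).prodMk (continuous_apply (τ + 1)))
    have h2 : IsClosed {y : ℕ → W | ∀ τ ≤ t, UnseenAt T k σ τ (y τ)} := by
      simp only [Set.ofPred_forall]
      refine isClosed_iInter fun τ => isClosed_iInter fun _ => ?_
      exact (isClosed_discrete {v : W | UnseenAt T k σ τ v}).preimage
        (f := fun y : ℕ → W => y τ) (continuous_apply τ)
    exact h1.inter h2
  obtain ⟨y, hy⟩ := IsCompact.nonempty_iInter_of_sequence_nonempty_isCompact_isClosed C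
    (fun t y hy => ⟨hy.1, fun τ hτ => hy.2 τ (by omega)⟩)
    (fun t => by obtain ⟨v, y, h1, h2, -⟩ := h t; exact ⟨y, h1, h2⟩)
    (hclosed 0).isCompact hclosed
  rw [Set.mem_iInter] at hy
  exact ⟨y, (hy 0).1, fun t => (hy t).2 t le_rfl⟩

/-- If there are always two vertices where a robber can be without having been seen, then the
candidate is never unique for a robber who is never seen. -/
theorem not_copsWin_of_unseenReach [Finite W]
    (h : ∀ σ : CopStrategy W m, ∀ t,
      ∃ v w, v ≠ w ∧ UnseenReach T k σ t v ∧ UnseenReach T k σ t w) :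
    ¬ CopsWin T k m := by
  rintro ⟨σ, hσ⟩
  obtain ⟨x, hx, hunseen⟩ := exists_unseen_forever (σ := σ) fun t =>
    let ⟨v, _, _, hv, _⟩ := h σ t; ⟨v, hv⟩
  obtain ⟨t, z, hz⟩ := hσ x hx
  have hcand : ∀ v, UnseenReach T k σ t v → v = z := by
    rintro v ⟨y, hy, hun, hv⟩
    rw [← Set.mem_singleton_iff, ← hz]
    refine ⟨y, hy, ?_, hv⟩
    rw [history_of_unseen fun τ hτ => hun τ (Nat.le_of_lt_succ hτ),
      history_of_unseen fun τ _ => hunseen τ]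
  obtain ⟨v, w, hne, hv, hw⟩ := h σ t
  exact hne ((hcand v hv).trans (hcand w hw).symm)

/-- A cop on every vertex finds the robber at once. -/
theorem copsWin_card [Finite W] (T : SimpleGraph W) (k : ℕ) : CopsWin T k (Nat.card W) := by
  let e : Fin (Nat.card W) ≃ W := (Finite.equivFin W).symm
  refine ⟨fun _ => e, fun x hx => ⟨0, x 0, ?_⟩⟩
  ext v
  simp only [candidates, Set.mem_ofPred_eq, Set.mem_singleton_iff]
  constructor
  · rintro ⟨y, -, hyx, rfl⟩
    simp only [history, List.cons.injEq, and_true] at hyx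
    have h1 := congrFun hyx (e.symm (x 0))
    simp only [Equiv.apply_symm_apply, probe, SimpleGraph.edist_self, zero_le, if_true,
      SimpleGraph.dist_self] at h1
    split_ifs at h1 with h2
    · have h3 : T.Reachable (x 0) (y 0) :=
        SimpleGraph.reachable_of_edist_ne_top (ne_top_of_le_ne_top (by simp) h2)
      exact (h3.dist_eq_zero_iff.1 (Option.some_injective _ h1)).symm
  · rintro rfl
    exact ⟨x, hx, rfl, rfl⟩

theorem zeta_mem [Finite W] [Nonempty W] (T : SimpleGraph W) (k : ℕ) :
    0 < zeta T k ∧ CopsWin T k (zeta T k) :=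
  Nat.sInf_mem (s := {m | 0 < m ∧ CopsWin T k m}) ⟨_, Nat.card_pos, copsWin_card T k⟩

/-- A robber on a graph `T` that contains a blown-up copy of `G`, with edges of length `L`, evades
`m` cops if each cop in each round can disturb only one vertex of `G` and the edges at this vertex,
and `G` has vertex boundaries of size at least `2 * (m * L)` at some volume `s`. During `L` rounds
the cops disturb at most `m * L` vertices; from at least `s` undisturbed vertices that the robber
can occupy, the robber can get to all vertices of their closed neighbourhood that are undisturbed,
hence to at least `s + m * L` vertices. -/
theorem not_copsWin_of_vertexIso [Finite W] {V : Type*} [Finite V] (G : SimpleGraph V) {L s : ℕ}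
    (φ : V → W) (hφ : Function.Injective φ) (a : W → V)
    (hvert : ∀ u x, T.edist u (φ x) ≤ (k : ℕ∞) → a u = x)
    (hedge : ∀ x y, G.Adj x y → ∃ p : T.Walk (φ x) (φ y), p.length = L ∧
      ∀ z ∈ p.support, ∀ u, T.edist u z ≤ (k : ℕ∞) → a u = x ∨ a u = y)
    (hL : 0 < L) (hs : 2 ≤ s) (hsV : s ≤ Nat.card V) (hiso : 2 * (m * L) ≤ vertexIso G s) :
    ¬ CopsWin T k m := by
  classical
  have := Fintype.ofFinite V
  refine not_copsWin_of_unseenReach fun σ => ?_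
  -- the vertices of `G` that a robber can occupy at the beginning of the `i`-th block of `L` rounds
  let D : ℕ → Finset V := fun i => Finset.univ.filter fun x => UnseenReach T k σ (i * L) (φ x)
  -- the vertices disturbed during the block
  let P : ℕ → Finset V := fun i => (Finset.univ : Finset (Fin m × Fin L)).image
    fun p => a (blindProbe σ (i * L + (p.2 + 1)) p.1)
  have hP : ∀ i, (P i).card ≤ m * L := fun i =>
    Finset.card_image_le.trans (by simp)
  have hPmem : ∀ i j c, 1 ≤ j → j ≤ L → a (blindProbe σ (i * L + j) c) ∈ P i := by
    intro i j c h1 h2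
    refine Finset.mem_image.2 ⟨(c, ⟨j - 1, by omega⟩), Finset.mem_univ _, ?_⟩
    simp only [Nat.sub_add_cancel h1]
  have hstay : ∀ i x, x ∈ D i → x ∉ P i → ∀ n ≤ L, UnseenReach T k σ (i * L + n) (φ x) := by
    intro i x hx hxP n hn
    induction n with
    | zero => exact (Finset.mem_filter.1 hx).2
    | succ n ih =>
      refine (ih (by omega)).succ (Or.inl rfl) fun c hc => hxP ?_
      rw [← hvert _ _ hc]
      exact hPmem i (n + 1) c (by omega) hn
  have hmove : ∀ i x y, x ∈ D i → x ∉ P i → y ∉ P i → G.Adj x y → y ∈ D (i + 1) := by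
    intro i x y hx hxP hyP hxy
    obtain ⟨p, hpL, hp⟩ := hedge x y hxy
    have h1 := UnseenReach.of_walk (Finset.mem_filter.1 hx).2 p L fun j h1 h2 c hc => by
      rcases hp _ (p.getVert_mem_support j) _ hc with h | h
      · exact hxP (h ▸ hPmem i j c h1 h2)
      · exact hyP (h ▸ hPmem i j c h1 h2)
    rw [← hpL, p.getVert_length, hpL, ← Nat.succ_mul] at h1
    exact Finset.mem_filter.2 ⟨Finset.mem_univ _, h1⟩
  have hborder : ∀ S : Finset V, S.card = s → ∃ B : Finset V,
      (B : Set V) = border G (S : Set V) ∧ 2 * (m * L) ≤ B.card ∧ Disjoint S B := by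
    intro S hS
    refine ⟨(border G (S : Set V)).toFinset, by simp, ?_, ?_⟩
    · rw [← Set.ncard_eq_toFinset_card']
      exact hiso.trans (hS ▸ vertexIso_le G)
    · rw [Finset.disjoint_left]
      intro v hv hvB
      exact (Set.mem_toFinset.1 hvB).1 hv
  have hcard : ∀ i, s + m * L ≤ (D i).card := by
    intro i
    induction i with
    | zero =>
      obtain ⟨S, -, hS⟩ := Finset.exists_subset_card_eq
        (s := (Finset.univ : Finset V)) (n := s) (by simpa using hsV)
      obtain ⟨B, -, hB, hSB⟩ := hborder S hS
      let P₀ : Finset V := Finset.univ.image fun c => a (blindProbe σ 0 c)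
      have hP₀ : P₀.card ≤ m * L :=
        (Finset.card_image_le.trans (by simp)).trans (Nat.le_mul_of_pos_right m hL)
      have hsub : (S ∪ B) \ P₀ ⊆ D 0 := by
        intro x hx
        refine Finset.mem_filter.2 ⟨Finset.mem_univ _, ?_⟩
        rw [zero_mul]
        refine UnseenReach.zero fun c hc => (Finset.mem_sdiff.1 hx).2 ?_
        rw [← hvert _ _ hc]
        exact Finset.mem_image_of_mem _ (Finset.mem_univ _)
      have h1 := Finset.card_le_card hsub
      have h2 := Finset.le_card_sdiff P₀ (S ∪ B)
      rw [Finset.card_union_of_disjoint hSB] at h2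
      omega
    | succ i ih =>
      have h0 := Finset.le_card_sdiff (P i) (D i)
      have hPi := hP i
      obtain ⟨S, hSsub, hS⟩ := Finset.exists_subset_card_eq
        (s := D i \ P i) (n := s) (by omega)
      obtain ⟨B, hBeq, hB, hSB⟩ := hborder S hS
      have hsub : (S ∪ B) \ P i ⊆ D (i + 1) := by
        intro x hx
        obtain ⟨hx, hxP⟩ := Finset.mem_sdiff.1 hx
        rcases Finset.mem_union.1 hx with hxS | hxB
        · have h1 := hstay i x (Finset.mem_sdiff.1 (hSsub hxS)).1 hxP L le_rfl
          rw [← Nat.succ_mul] at h1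
          exact Finset.mem_filter.2 ⟨Finset.mem_univ _, h1⟩
        · rw [← Finset.mem_coe, hBeq] at hxB
          obtain ⟨-, u, hu, hux⟩ := hxB
          obtain ⟨huD, huP⟩ := Finset.mem_sdiff.1 (hSsub hu)
          exact hmove i u x huD huP hxP hux
      have h1 := Finset.card_le_card hsub
      have h2 := Finset.le_card_sdiff (P i) (S ∪ B)
      rw [Finset.card_union_of_disjoint hSB] at h2
      omega
  intro t
  have h0 := Finset.le_card_sdiff (P (t / L)) (D (t / L))
  have h1 := hcard (t / L)
  have h2 := hP (t / L)
  have h4 : 1 < (D (t / L) \ P (t / L)).card := by omega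
  obtain ⟨x, hx, y, hy, hxy⟩ := Finset.one_lt_card.1 h4
  have h3 : t / L * L + t % L = t := Nat.div_add_mod' t L
  rw [Finset.mem_sdiff] at hx hy
  rw [← h3]
  exact ⟨φ x, φ y, hφ.ne hxy, hstay _ x hx.1 hx.2 _ (Nat.mod_lt t hL).le,
    hstay _ y hy.1 hy.2 _ (Nat.mod_lt t hL).le⟩

end Game

/-! ### Trees given by a parent map -/

section ParentGraph

variable {W : Type*}

/-- The graph in which every vertex is joined to its parent; a root is its own parent. -/
def parentGraph (par : W → W) : SimpleGraph W :=
  SimpleGraph.fromRel fun u v => par u = v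

variable {par : W → W} {r : W} {dep : W → ℕ}

theorem parentGraph_adj {u v : W} :
    (parentGraph par).Adj u v ↔ u ≠ v ∧ (par u = v ∨ par v = u) :=
  SimpleGraph.fromRel_adj _ _ _

theorem parentGraph_adj_parent (hdep : ∀ w, w ≠ r → dep (par w) + 1 = dep w) {w : W} (hw : w ≠ r) :
    (parentGraph par).Adj w (par w) :=
  parentGraph_adj.2 ⟨fun h => by have := hdep w hw; rw [← h] at this; omega, Or.inl rfl⟩

theorem exists_walk_root (hdep : ∀ w, w ≠ r → dep (par w) + 1 = dep w) (w : W) :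
    ∃ p : (parentGraph par).Walk w r, p.length ≤ dep w := by
  induction hn : dep w generalizing w with
  | zero =>
    obtain rfl : w = r := by
      by_contra h
      have := hdep w h
      omega
    exact ⟨.nil, by simp⟩
  | succ n ih =>
    by_cases h : w = r
    · subst h
      exact ⟨.nil, by simp⟩
    · obtain ⟨p, hp⟩ := ih (par w) (by have := hdep w h; omega)
      exact ⟨.cons (parentGraph_adj_parent hdep h) p, by simpa using hp⟩

theorem parentGraph_isTree [Finite W] (hr : par r = r)
    (hdep : ∀ w, w ≠ r → dep (par w) + 1 = dep w) : (parentGraph par).IsTree := by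
  have hconn : (parentGraph par).Connected := by
    have : Nonempty W := ⟨r⟩
    refine ⟨fun u v => ?_⟩
    obtain ⟨p, -⟩ := exists_walk_root hdep u
    obtain ⟨p', -⟩ := exists_walk_root hdep v
    exact p.reachable.trans p'.reachable.symm
  refine SimpleGraph.isTree_iff_connected_and_card.2 ⟨hconn, le_antisymm ?_
    hconn.card_vert_le_card_edgeSet_add_one⟩
  -- every edge joins a vertex other than the root to its parent
  have hsurj : Function.Surjective fun w : {w // w ≠ r} =>
      (⟨s(w.1, par w.1), parentGraph_adj_parent hdep w.2⟩ : (parentGraph par).edgeSet) := by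
    rintro ⟨e, he⟩
    induction e with
    | _ u v =>
      have hadj := parentGraph_adj.1 ((parentGraph par).mem_edgeSet.1 he)
      rcases hadj with ⟨hne, rfl | rfl⟩
      · exact ⟨⟨u, fun h => hne (by rw [h, hr])⟩, rfl⟩
      · exact ⟨⟨v, fun h => hne (by rw [h, hr])⟩, Subtype.ext Sym2.eq_swap⟩
  have h1 : Nat.card (parentGraph par).edgeSet ≤ _ := Nat.card_le_card_of_surjective _ hsurj
  have h2 : Nat.card {w // w ≠ r} + 1 = Nat.card W := by
    rw [← Finite.card_option]
    classical
    exact Nat.card_congr (Equiv.optionSubtypeNe r)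
  omega

theorem le_edist_of_lipschitz {G : SimpleGraph W} (f : W → ℤ)
    (hf : ∀ u v, G.Adj u v → f v ≤ f u + 1) {u v : W} {n : ℕ} (hn : f u + n ≤ f v) :
    (n : ℕ∞) ≤ G.edist u v := by
  refine le_iInf fun p => ?_
  have h : f v ≤ f u + p.length := by
    clear hn
    induction p with
    | nil => simp
    | cons hadj p ih =>
      have := hf _ _ hadj
      rw [SimpleGraph.Walk.length_cons]
      push_cast
      omega
  exact_mod_cast (by omega : n ≤ p.length)

end ParentGraph

/-! ### The blown-up tree -/

section Blowup

/-- The length of the path that replaces the edge from a word `l ≠ []` to its parent: `2 * k + 1`,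
but only `k` if `l` is a leaf of the complete tree of height `d + 1`. The root is treated like a
word with a path of length `1` above it. -/
def blowupLength {q : ℕ} (d k : ℕ) : List (Fin q) → ℕ
  | [] => 1
  | a :: l => if (a :: l).length ≤ d then 2 * k + 1 else k

/-- The vertices of the blown-up tree: `(l, i)` is the vertex at distance `i` from `l` on the path
from `l` to its parent. The parent itself does not count as a vertex of this path; so for `k = 0`,
leaves of the complete tree of height `d + 1` are merged with their parents. -/
abbrev Blowup (d q k : ℕ) : Type :=
  {w : List (Fin q) × ℕ // w.1.length ≤ d + 1 ∧ w.2 < blowupLength d k w.1}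

variable {d q k : ℕ}

theorem blowupLength_of_le {l : List (Fin q)} (hl : l ≠ []) (hld : l.length ≤ d) :
    blowupLength d k l = 2 * k + 1 := by
  cases l with
  | nil => exact absurd rfl hl
  | cons a l => exact if_pos hld

theorem blowupLength_of_lt {l : List (Fin q)} (hld : d < l.length) : blowupLength d k l = k := by
  cases l with
  | nil => simp at hld
  | cons a l => exact if_neg (by omega)

theorem blowupLength_pos {l : List (Fin q)} (hl : l.length ≤ d) : 0 < blowupLength d k l := by
  cases l with
  | nil => exact Nat.one_pos
  | cons a l => rw [blowupLength_of_le (by simp) hl]; omega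

theorem blowupLength_le (l : List (Fin q)) : blowupLength d k l ≤ 2 * k + 1 := by
  cases l with
  | nil => simp [blowupLength]
  | cons a l => rw [blowupLength]; split_ifs <;> omega

instance : Finite (Blowup d q k) := by
  refine Set.Finite.subset
    ((List.finite_length_le (Fin q) (d + 1)).prod (Set.finite_lt_nat (2 * k + 1))) ?_
  rintro ⟨l, i⟩ ⟨hl, hi⟩
  exact ⟨hl, hi.trans_le (blowupLength_le l)⟩

/-- The vertex of the blown-up tree at a word that is not a leaf. -/
def Blowup.node (l : List (Fin q)) (hl : l.length ≤ d) : Blowup d q k :=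
  ⟨(l, 0), by simp only; omega, blowupLength_pos hl⟩

theorem length_tail_le {l : List (Fin q)} (hl : l.length ≤ d + 1) : l.tail.length ≤ d := by
  rw [List.length_tail]; omega

/-- The next vertex on the way to the root. -/
def Blowup.parent (w : Blowup d q k) : Blowup d q k :=
  if h : w.1.2 + 1 < blowupLength d k w.1.1 then ⟨(w.1.1, w.1.2 + 1), w.2.1, h⟩
  else .node w.1.1.tail (length_tail_le w.2.1)

/-- The distance to the root. -/
def Blowup.depth (w : Blowup d q k) : ℕ :=
  if w.1.1 = [] then 0
  else (w.1.1.length - 1) * (2 * k + 1) + blowupLength d k w.1.1 - w.1.2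

/-- The blown-up tree. -/
def blowupTree (d q k : ℕ) : SimpleGraph (Blowup d q k) :=
  parentGraph Blowup.parent

/-- The root of the blown-up tree. -/
def Blowup.root : Blowup d q k := .node [] (Nat.zero_le _)

open Blowup

theorem Blowup.eq_root {w : Blowup d q k} (hw : w.1.1 = []) : w = root := by
  obtain ⟨⟨l, i⟩, hl, hi⟩ := w
  subst hw
  have : i = 0 := Nat.lt_one_iff.1 hi
  subst this
  rfl

theorem Blowup.parent_root : parent (root : Blowup d q k) = root :=
  dif_neg (by simp [root, node, blowupLength])

theorem Blowup.parent_cases (w : Blowup d q k) :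
    (w.1.2 + 1 < blowupLength d k w.1.1 ∧ (parent w).1 = (w.1.1, w.1.2 + 1)) ∨
      (w.1.2 + 1 = blowupLength d k w.1.1 ∧ parent w = node w.1.1.tail (length_tail_le w.2.1)) := by
  by_cases h : w.1.2 + 1 < blowupLength d k w.1.1
  · exact Or.inl ⟨h, by rw [parent, dif_pos h]⟩
  · exact Or.inr ⟨le_antisymm w.2.2 (not_lt.1 h), by rw [parent, dif_neg h]⟩

theorem Blowup.depth_node (l : List (Fin q)) (hl : l.length ≤ d) :
    depth (node l hl : Blowup d q k) = l.length * (2 * k + 1) := by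
  cases l with
  | nil => simp [depth, node]
  | cons a l =>
    have h1 : depth (node (a :: l) hl : Blowup d q k) =
        l.length * (2 * k + 1) + blowupLength d k (a :: l) := if_neg (by simp [node])
    rw [h1, blowupLength_of_le (by simp) hl, List.length_cons, Nat.add_mul, one_mul]

theorem Blowup.depth_parent (w : Blowup d q k) (hw : w ≠ root) :
    depth (parent w) + 1 = depth w := by
  have hne : w.1.1 ≠ [] := fun h => hw (eq_root h)
  have hlt := w.2.2
  rcases parent_cases w with ⟨h, hp⟩ | ⟨h, hp⟩
  · rw [depth, depth, hp, if_neg hne, if_neg hne]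
    simp only
    omega
  · rw [hp, depth_node, depth, if_neg hne, List.length_tail]
    omega

theorem blowupTree_isTree : (blowupTree d q k).IsTree :=
  parentGraph_isTree parent_root depth_parent

theorem Blowup.depth_le (w : Blowup d q k) : depth w ≤ d * (2 * k + 1) + k := by
  rw [depth]
  split_ifs with hne
  · exact Nat.zero_le _
  have hpos := List.length_pos_iff.2 hne
  rcases w.2.1.lt_or_eq with h | h
  · rw [blowupLength_of_le hne (by omega), ← Nat.succ_mul]
    have := Nat.mul_le_mul_right (2 * k + 1) (show (w.1.1.length - 1).succ ≤ d by omega)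
    omega
  · rw [blowupLength_of_lt (by omega), h, Nat.add_sub_cancel]
    omega

theorem Blowup.adj_cases {P : Blowup d q k → Blowup d q k → Prop}
    (h1 : ∀ w, w ≠ root → P w (parent w)) (h2 : ∀ w, w ≠ root → P (parent w) w)
    {u v : Blowup d q k} (huv : (blowupTree d q k).Adj u v) : P u v := by
  rcases parentGraph_adj.1 huv with ⟨hne, rfl | rfl⟩
  · exact h1 u fun h => hne (by rw [h, parent_root])
  · exact h2 v fun h => hne (by rw [h, parent_root])

theorem Blowup.exists_depth_eq (hd : 0 < d) (a : Fin q) :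
    ∃ w : Blowup d q k, w.1.1.getLast? = some a ∧ depth w = d * (2 * k + 1) + k := by
  rcases Nat.eq_zero_or_pos k with rfl | hk
  · refine ⟨node (List.replicate d a) (by simp), ?_, ?_⟩
    · simp [node, List.getLast?_replicate, hd.ne']
    · simp [depth_node]
  · refine ⟨⟨(List.replicate (d + 1) a, 0), by simp, ?_⟩, ?_, ?_⟩
    · rwa [blowupLength_of_lt (by simp)]
    · simp [List.getLast?_replicate]
    · rw [depth, if_neg (by simp)]
      simp only
      rw [blowupLength_of_lt (by simp)]
      simp

/-- From every vertex, the leaves in another branch at the root are at least as far away as from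
the root. -/
theorem blowupTree_radius (hd : 0 < d) (hq : 2 ≤ q) :
    (blowupTree d q k).radius = ((d * (2 * k + 1) + k : ℕ) : ℕ∞) := by
  refine le_antisymm (iInf_le_of_le root ?_) (le_iInf fun u => ?_)
  · refine (SimpleGraph.eccent_le_iff _ _).2 fun v => ?_
    obtain ⟨p, hp⟩ := exists_walk_root depth_parent v
    rw [SimpleGraph.edist_comm]
    exact (SimpleGraph.edist_le p).trans (by exact_mod_cast hp.trans (depth_le v))
  · obtain ⟨a, ha⟩ : ∃ a : Fin q, u.1.1.getLast? ≠ some a := by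
      by_contra! h
      have h1 := (h ⟨0, by omega⟩).symm.trans (h ⟨1, by omega⟩)
      simp at h1
    obtain ⟨v, hva, hv⟩ := exists_depth_eq (k := k) hd a
    refine le_trans ?_ (SimpleGraph.edist_le_eccent (v := v))
    -- the signed distance to the root, positive in the branch `a`
    let f : Blowup d q k → ℤ := fun w => if w.1.1.getLast? = some a then depth w else -depth w
    have hf : ∀ w, w ≠ root → |f (parent w) - f w| ≤ 1 := by
      intro w hw
      have hdep := depth_parent w hw
      have hcase : depth (parent w) = 0 ∨ (parent w).1.1.getLast? = w.1.1.getLast? := by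
        rcases parent_cases w with ⟨-, hp⟩ | ⟨-, hp⟩
        · right; rw [hp]
        · rw [hp]
          by_cases ht : w.1.1.tail = []
          · left; simp [depth, node, ht]
          · right
            simp only [node]
            obtain ⟨b, l, hbl⟩ := List.exists_cons_of_ne_nil (fun h => hw (eq_root h))
            rw [hbl] at ht ⊢
            obtain ⟨c, l', rfl⟩ := List.exists_cons_of_ne_nil ht
            simp
      rw [abs_le]
      simp only [f]
      rcases hcase with h | h
      · rw [h]; split_ifs <;> push_cast <;> omega
      · rw [h]; split_ifs <;> omega
    refine le_edist_of_lipschitz f (fun x y hxy => ?_) ?_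
    · refine adj_cases (P := fun x y => f y ≤ f x + 1) (fun w hw => ?_) (fun w hw => ?_) hxy
      · have := abs_le.1 (hf w hw); omega
      · have := abs_le.1 (hf w hw); omega
    · simp only [f, if_neg ha, if_pos hva, hv]
      omega

end Blowup

/-! ### Balls in the blown-up tree -/

section Anchor

open Blowup

variable {d q k : ℕ}

/-- The inner vertex of the complete tree that is nearest to `w`. -/
def Blowup.anchor (w : Blowup d q k) : Word d q :=
  if h : w.1.1.length ≤ d ∧ w.1.2 ≤ k then ⟨w.1.1, h.1⟩ else ⟨w.1.1.tail, length_tail_le w.2.1⟩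

/-- The distance of `w` to its anchor. -/
def Blowup.offset (w : Blowup d q k) : ℕ :=
  if w.1.1.length ≤ d ∧ w.1.2 ≤ k then w.1.2 else blowupLength d k w.1.1 - w.1.2

theorem Blowup.anchor_eq_of_le {w : Blowup d q k} (hd : w.1.1.length ≤ d) (hk : w.1.2 ≤ k) :
    anchor w = ⟨w.1.1, hd⟩ ∧ offset w = w.1.2 :=
  ⟨dif_pos ⟨hd, hk⟩, if_pos ⟨hd, hk⟩⟩

theorem Blowup.anchor_eq_of_not {w : Blowup d q k} (h : ¬ (w.1.1.length ≤ d ∧ w.1.2 ≤ k)) :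
    anchor w = ⟨w.1.1.tail, length_tail_le w.2.1⟩ ∧ offset w = blowupLength d k w.1.1 - w.1.2 :=
  ⟨dif_neg h, if_neg h⟩

@[simp] theorem Blowup.anchor_node (x : Word d q) : anchor (node x.1 x.2 : Blowup d q k) = x :=
  dif_pos ⟨x.2, Nat.zero_le _⟩

@[simp] theorem Blowup.offset_node (l : List (Fin q)) (hl : l.length ≤ d) :
    offset (node l hl : Blowup d q k) = 0 :=
  if_pos ⟨hl, Nat.zero_le _⟩

/-- Along an edge, the anchor changes only between vertices of the maximal offset `k`. -/
theorem Blowup.anchor_adj {u v : Blowup d q k} (huv : (blowupTree d q k).Adj u v)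
    (hu : offset u < k) : anchor v = anchor u ∧ offset v ≤ offset u + 1 := by
  revert hu
  suffices H : ∀ w : Blowup d q k, w ≠ root → (offset w < k ∨ offset (parent w) < k) →
      anchor (parent w) = anchor w ∧ offset (parent w) ≤ offset w + 1 ∧
        offset w ≤ offset (parent w) + 1 by
    refine adj_cases (P := fun u v => offset u < k → anchor v = anchor u ∧
      offset v ≤ offset u + 1) (fun w hw h => ?_) (fun w hw h => ?_) huv
    · exact ⟨(H w hw (Or.inl h)).1, (H w hw (Or.inl h)).2.1⟩
    · exact ⟨(H w hw (Or.inr h)).1.symm, (H w hw (Or.inr h)).2.2⟩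
  intro w hw hk
  have hne : w.1.1 ≠ [] := fun h => hw (eq_root h)
  have hlen := w.2.1
  have hlt := w.2.2
  have hL : w.1.1.length ≤ d ∧ blowupLength d k w.1.1 = 2 * k + 1 ∨
      w.1.1.length = d + 1 ∧ blowupLength d k w.1.1 = k := by
    by_cases h : w.1.1.length ≤ d
    · exact Or.inl ⟨h, blowupLength_of_le hne h⟩
    · exact Or.inr ⟨by omega, blowupLength_of_lt (by omega)⟩
  rcases parent_cases w with ⟨h, hp⟩ | ⟨h, hp⟩
  · have hp1 : (parent w).1.1 = w.1.1 := by rw [hp]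
    have hp2 : (parent w).1.2 = w.1.2 + 1 := by rw [hp]
    have hpa : (parent w).anchor = if h : w.1.1.length ≤ d ∧ w.1.2 + 1 ≤ k then ⟨w.1.1, h.1⟩ else
        ⟨w.1.1.tail, length_tail_le w.2.1⟩ := by
      unfold anchor; simp only [hp1, hp2]
    have hpo : (parent w).offset = if w.1.1.length ≤ d ∧ w.1.2 + 1 ≤ k then w.1.2 + 1 else
        blowupLength d k w.1.1 - (w.1.2 + 1) := by
      unfold offset; simp only [hp1, hp2]
    rw [hpo] at hk ⊢
    rw [hpa]
    by_cases h1 : w.1.1.length ≤ d ∧ w.1.2 ≤ k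
    · obtain ⟨ha, ho⟩ := anchor_eq_of_le h1.1 h1.2
      rw [ho] at hk ⊢
      rw [ha]
      have h2 : w.1.1.length ≤ d ∧ w.1.2 + 1 ≤ k := by
        refine ⟨h1.1, ?_⟩
        split_ifs at hk <;> omega
      rw [dif_pos h2, if_pos h2]
      exact ⟨rfl, by omega, by omega⟩
    · obtain ⟨ha, ho⟩ := anchor_eq_of_not h1
      rw [ho] at hk ⊢
      rw [ha]
      have h2 : ¬ (w.1.1.length ≤ d ∧ w.1.2 + 1 ≤ k) := by omega
      rw [dif_neg h2, if_neg h2]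
      exact ⟨rfl, by omega, by omega⟩
  · have hpa := anchor_node (k := k) ⟨w.1.1.tail, length_tail_le w.2.1⟩
    simp only at hpa
    rw [hp, hpa, offset_node]
    rw [hp, offset_node] at hk
    by_cases h1 : w.1.1.length ≤ d ∧ w.1.2 ≤ k
    · obtain ⟨ha, ho⟩ := anchor_eq_of_le h1.1 h1.2
      rw [ho] at hk
      omega
    · obtain ⟨ha, ho⟩ := anchor_eq_of_not h1
      rw [ho, ha]
      exact ⟨rfl, by omega, by omega⟩

/-- A walk changes the anchor only after more than `k - offset w` steps. In particular, a ball of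
radius `k` around a vertex with offset `0` contains only vertices anchored there. -/
theorem Blowup.anchor_eq_of_walk {w u : Blowup d q k} (p : (blowupTree d q k).Walk w u)
    (hp : offset w + p.length ≤ k) : anchor u = anchor w := by
  induction p with
  | nil => rfl
  | cons hadj p ih =>
    rw [SimpleGraph.Walk.length_cons] at hp
    obtain ⟨h1, h2⟩ := anchor_adj hadj (by omega)
    rw [ih (by omega), h1]

theorem exists_walk_of_edist_le {W : Type*} {G : SimpleGraph W} {u v : W}
    (h : G.edist u v ≤ (k : ℕ∞)) : ∃ p : G.Walk v u, p.length ≤ k := by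
  obtain ⟨p, hp⟩ := SimpleGraph.exists_walk_of_edist_ne_top
    (ne_top_of_le_ne_top (by simp) h)
  refine ⟨p.reverse, ?_⟩
  rw [← hp] at h
  rw [SimpleGraph.Walk.length_reverse]
  exact_mod_cast h

/-- A ball of radius `k` around a point of the path from `y` to its parent does not reach beyond the
part of the tree that is nearest to one of the two ends: a walk that leaves the path passes through
one of the ends. -/
theorem Blowup.anchor_eq_or_of_walk {y : List (Fin q)} (hy : y.length ≤ d) {w u : Blowup d q k}
    (p : (blowupTree d q k).Walk w u) (hw : w.1.1 = y) (hp : p.length ≤ k) :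
    (anchor u).1 = y ∨ (anchor u).1 = y.tail := by
  induction p with
  | @nil w =>
    unfold anchor
    split_ifs
    · exact Or.inl hw
    · exact Or.inr (congrArg List.tail hw)
  | @cons w w' u hadj p ih =>
    rw [SimpleGraph.Walk.length_cons] at hp
    rcases Nat.eq_zero_or_pos w.1.2 with h0 | hpos
    · obtain ⟨h1, h2⟩ := anchor_eq_of_le (hw.symm ▸ hy) (h0 ▸ Nat.zero_le k)
      have := anchor_eq_of_walk (.cons hadj p) (by rw [SimpleGraph.Walk.length_cons]; omega)
      rw [this, h1]
      exact Or.inl hw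
    · have hw' : w'.1.1 = y ∨ w' = node y.tail (length_tail_le (by omega)) := by
        revert hw hpos
        refine adj_cases (P := fun w w' => w.1.1 = y → 0 < w.1.2 → w'.1.1 = y ∨
          w' = node y.tail (length_tail_le (by omega))) (fun v _ hv hpos => ?_)
          (fun v _ hv hpos => ?_) hadj
        · rcases parent_cases v with ⟨-, h⟩ | ⟨-, h⟩
          · left; rw [h]; exact hv
          · right; subst hv; exact h
        · rcases parent_cases v with ⟨-, h⟩ | ⟨-, h⟩
          · left; rw [h] at hv; exact hv
          · rw [h] at hpos
            exact absurd hpos (lt_irrefl 0)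
      rcases hw' with h | h
      · exact ih h (by omega)
      · right
        have h0 : offset w' = 0 := by rw [h, offset_node]
        rw [anchor_eq_of_walk p (by omega), h,
          anchor_node ⟨y.tail, length_tail_le (hy.trans (Nat.le_succ d))⟩]

/-- The way from a vertex of the path above `l` to the parent of `l`. -/
theorem Blowup.exists_path_to_parent {l : List (Fin q)} (hl : l ≠ []) (hld : l.length ≤ d + 1)
    (w : Blowup d q k) (hw : w.1.1 = l) :
    ∃ p : (blowupTree d q k).Walk w (node l.tail (length_tail_le hld)), p.IsPath ∧
      p.length + w.1.2 = blowupLength d k l ∧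
      (∀ z ∈ p.support, (z.1.1 = l ∧ w.1.2 ≤ z.1.2) ∨ z = node l.tail (length_tail_le hld)) ∧
      ∀ z : Blowup d q k, z.1.1 = l → w.1.2 ≤ z.1.2 → s(z, parent z) ∈ p.edges := by
  have hlast : ∀ w z : Blowup d q k, w.1.1 = l → z.1.1 = l → z.1.2 = w.1.2 → z = w :=
    fun w z hw hz h => Subtype.ext (Prod.ext (hz.trans hw.symm) h)
  have hnode : ∀ w : Blowup d q k, w.1.1 = l → w ≠ node l.tail (length_tail_le hld) := by
    rintro w hw rfl
    have h1 := congrArg List.length hw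
    have h2 := List.length_pos_iff.2 hl
    simp only [node, List.length_tail] at h1
    omega
  induction hn : blowupLength d k l - w.1.2 generalizing w with
  | zero =>
    have hlt := w.2.2
    rw [hw] at hlt
    omega
  | succ n ih =>
    have hadj : (blowupTree d q k).Adj w (parent w) :=
      parentGraph_adj_parent depth_parent fun h => hl (hw.symm.trans (by rw [h]; rfl))
    have hlt := w.2.2
    rw [hw] at hlt
    rcases parent_cases w with ⟨-, hp⟩ | ⟨h, hp⟩
    · have hp1 : (parent w).1.1 = l := by rw [hp]; exact hw
      have hp2 : (parent w).1.2 = w.1.2 + 1 := by rw [hp]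
      obtain ⟨p, hpath, hlen, hsupp, hedges⟩ := ih (parent w) hp1 (by rw [hp2]; omega)
      rw [hp2] at hlen hsupp hedges
      refine ⟨.cons hadj p, ?_, ?_, ?_, ?_⟩
      · rw [SimpleGraph.Walk.cons_isPath_iff]
        refine ⟨hpath, fun hmem => ?_⟩
        rcases hsupp w hmem with ⟨-, h1⟩ | h1
        · omega
        · exact hnode w hw h1
      · rw [SimpleGraph.Walk.length_cons]
        omega
      · intro z hz
        rw [SimpleGraph.Walk.support_cons, List.mem_cons] at hz
        rcases hz with rfl | hz
        · exact Or.inl ⟨hw, le_rfl⟩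
        · exact (hsupp z hz).imp_left fun h1 => ⟨h1.1, by omega⟩
      · intro z hz1 hz2
        rw [SimpleGraph.Walk.edges_cons, List.mem_cons]
        rcases hz2.lt_or_eq with h1 | h1
        · exact Or.inr (hedges z hz1 h1)
        · rw [hlast w z hw hz1 h1.symm]
          exact Or.inl rfl
    · rw [hw] at h
      have hp : parent w = node l.tail (length_tail_le hld) := by subst hw; exact hp
      rw [hp] at hadj
      refine ⟨.cons hadj .nil, ?_, ?_, ?_, ?_⟩
      · rw [SimpleGraph.Walk.cons_isPath_iff]
        refine ⟨.nil, ?_⟩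
        rw [SimpleGraph.Walk.support_nil, List.mem_singleton]
        exact hnode w hw
      · rw [SimpleGraph.Walk.length_cons, SimpleGraph.Walk.length_nil]
        omega
      · intro z hz
        rw [SimpleGraph.Walk.support_cons, List.mem_cons, SimpleGraph.Walk.support_nil,
          List.mem_singleton] at hz
        rcases hz with rfl | hz
        · exact Or.inl ⟨hw, le_rfl⟩
        · exact Or.inr hz
      · intro z hz1 hz2
        have h1 := z.2.2
        rw [hz1] at h1
        rw [hlast w z hw hz1 (by omega), SimpleGraph.Walk.edges_cons, hp]
        exact List.mem_cons_self

/-- Any `m` cops with `2 * (m * (2 * k + 1))` at most the isoperimetric peak of the complete tree of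
height `d` lose on the blown-up tree. -/
theorem not_copsWin_blowupTree {m : ℕ} (hq : 0 < q) (hm : 0 < m)
    (h : 2 * (m * (2 * k + 1)) ≤ vertexIsoPeak (completeTree d q)) :
    ¬ CopsWin (blowupTree d q k) k m := by
  obtain ⟨s, hs, hpeak⟩ := exists_vertexIso_eq_peak (completeTree d q)
  have hpos : 2 ≤ 2 * (m * (2 * k + 1)) := by
    have : 0 < m * (2 * k + 1) := by positivity
    omega
  have hs2 : 2 ≤ s := by
    by_contra! hlt
    have h0 := vertexIso_zero (completeTree d q)
    have h1 := vertexIso_completeTree_one_le (h := d) hq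
    interval_cases s <;> omega
  have hball : ∀ (u : Blowup d q k) (x : Word d q),
      (blowupTree d q k).edist u (node x.1 x.2) ≤ (k : ℕ∞) → anchor u = x := by
    intro u x hux
    obtain ⟨p, hp⟩ := exists_walk_of_edist_le hux
    rw [anchor_eq_of_walk p (by rwa [offset_node, zero_add]), anchor_node]
  have hup : ∀ (x y : Word d q) (a : Fin q), y.1 = a :: x.1 →
      ∃ p : (blowupTree d q k).Walk (node y.1 y.2) (node x.1 x.2), p.length = 2 * k + 1 ∧
        ∀ z ∈ p.support, ∀ u, (blowupTree d q k).edist u z ≤ (k : ℕ∞) →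
          anchor u = x ∨ anchor u = y := by
    rintro ⟨x, hx⟩ ⟨_, hy⟩ a rfl
    obtain ⟨p, -, hlen, hsupp, -⟩ := exists_path_to_parent (d := d) (k := k) (l := a :: x)
      (by simp) (hy.trans (Nat.le_succ d)) (node (a :: x) hy) rfl
    rw [blowupLength_of_le (by simp) hy] at hlen
    refine ⟨p, hlen, fun z hz u hu => ?_⟩
    rcases hsupp z hz with ⟨h1, -⟩ | rfl
    · obtain ⟨p', hp'⟩ := exists_walk_of_edist_le hu
      rcases anchor_eq_or_of_walk hy p' h1 hp' with h2 | h2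
      · exact Or.inr (Subtype.ext h2)
      · exact Or.inl (Subtype.ext h2)
    · exact Or.inl (hball u ⟨x, hx⟩ hu)
  refine not_copsWin_of_vertexIso (completeTree d q) (L := 2 * k + 1) (s := s)
    (fun x => node x.1 x.2) (fun x y hxy => ?_) anchor hball ?_ (by omega) hs2 hs (by omega)
  · exact Subtype.ext (congrArg (fun v : Blowup d q k => v.1.1) hxy)
  · rintro x y (⟨a, ha⟩ | ⟨a, ha⟩)
    · obtain ⟨p, hlen, hp⟩ := hup x y a ha
      refine ⟨p.reverse, by rw [SimpleGraph.Walk.length_reverse, hlen], fun z hz => ?_⟩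
      rw [SimpleGraph.Walk.support_reverse, List.mem_reverse] at hz
      exact hp z hz
    · obtain ⟨p, hlen, hp⟩ := hup y x a ha
      exact ⟨p, hlen, fun z hz u hu => (hp z hz u hu).symm⟩

end Anchor

/-! ### The visibility localization number of the blown-up tree -/

section Conclusion

open Blowup

variable {d q k : ℕ}

/-- If `k` is positive, then every edge is replaced by a path of positive length, even at the
leaves. -/
theorem isSubdivision_blowupTree (hk : 1 ≤ k) :
    IsSubdivision (completeTree (d + 1) q) (blowupTree d q k) := by
  classical
  let φ : Word (d + 1) q ↪ Blowup d q k :=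
    ⟨fun x => ⟨(x.1, 0), x.2, by
      change 0 < blowupLength d k x.1
      rcases x.2.lt_or_eq with h | h
      · exact blowupLength_pos (by omega)
      · rwa [blowupLength_of_lt (by omega)]⟩,
      fun x y h => Subtype.ext (congrArg (fun w : Blowup d q k => w.1.1) h)⟩
  have hup : ∀ u v : Word (d + 1) q, (∃ a, v.1 = a :: u.1) →
      ∃ p : (blowupTree d q k).Walk (φ v) (φ u), p.IsPath ∧
        (∀ z ∈ p.support, z.1.1 = v.1 ∨ z = φ u) ∧
        ∀ z : Blowup d q k, z.1.1 = v.1 → s(z, parent z) ∈ p.edges := by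
    rintro ⟨u, hu⟩ ⟨_, hv⟩ ⟨a, rfl⟩
    obtain ⟨p, h1, -, h2, h3⟩ := exists_path_to_parent (by simp) hv (φ ⟨a :: u, hv⟩) rfl
    exact ⟨p, h1, fun z hz => (h2 z hz).imp_left fun h => h.1,
      fun z hz => h3 z hz (Nat.zero_le _)⟩
  choose Q hQpath hQsupp hQedges using hup
  have hasymm : ∀ u v : Word (d + 1) q, (∃ a, v.1 = a :: u.1) → ¬ ∃ a, u.1 = a :: v.1 := by
    rintro u v ⟨a, h⟩ ⟨b, h'⟩
    have h1 := congrArg List.length h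
    have h2 := congrArg List.length h'
    rw [List.length_cons] at h1 h2
    omega
  let P : ∀ ⦃u v : Word (d + 1) q⦄, (completeTree (d + 1) q).Adj u v →
      (blowupTree d q k).Walk (φ u) (φ v) := fun u v e =>
    if h : ∃ a, v.1 = a :: u.1 then (Q u v h).reverse else Q v u (e.resolve_left h)
  have hP : ∀ ⦃u v : Word (d + 1) q⦄ (e : (completeTree (d + 1) q).Adj u v),
      (P e).IsPath ∧ ∃ c p : Word (d + 1) q, s(u, v) = s(p, c) ∧ (∃ a, c.1 = a :: p.1) ∧
        (∀ z ∈ (P e).support, z.1.1 = c.1 ∨ z = φ p) ∧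
        ∀ z : Blowup d q k, z.1.1 = c.1 → s(z, parent z) ∈ (P e).edges := by
    intro u v e
    by_cases h : ∃ a, v.1 = a :: u.1
    · simp only [P, dif_pos h]
      refine ⟨(hQpath u v h).reverse, v, u, rfl, h, fun z hz => hQsupp u v h z ?_,
        fun z hz => ?_⟩
      · simpa using hz
      · simpa using hQedges u v h z hz
    · simp only [P, dif_neg h]
      exact ⟨hQpath _ _ _, u, v, Sym2.eq_swap, e.resolve_left h, hQsupp _ _ _, hQedges _ _ _⟩
  have hedge : ∀ w : Blowup d q k, w ≠ root →
      ∃ (u v : Word (d + 1) q) (e : (completeTree (d + 1) q).Adj u v),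
        s(w, parent w) ∈ (P e).edges := by
    intro w hw
    obtain ⟨a, l, hal⟩ := List.exists_cons_of_ne_nil fun h => hw (eq_root h)
    have hlen := w.2.1
    have hlen' : l.length ≤ d + 1 := by rw [hal, List.length_cons] at hlen; omega
    refine ⟨⟨l, hlen'⟩, ⟨w.1.1, hlen⟩, Or.inl ⟨a, hal⟩, ?_⟩
    obtain ⟨-, c, p, huv, ⟨b, hb⟩, -, hedges⟩ := hP (Or.inl ⟨a, hal⟩ :
      (completeTree (d + 1) q).Adj ⟨l, hlen'⟩ ⟨w.1.1, hlen⟩)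
    refine hedges w ?_
    rcases Sym2.eq_iff.1 huv with ⟨-, h⟩ | ⟨h1, h2⟩
    · rw [← h]
    · rw [← h1, ← h2] at hb
      exact absurd ⟨b, hb⟩ (hasymm ⟨l, hlen'⟩ ⟨w.1.1, hlen⟩ ⟨a, hal⟩)
  refine ⟨φ, P, fun u v e => (hP e).1, fun u v e => ?_, fun u v e x hx => ?_,
    fun u v u' v' e e' w hw hw' hφ => ?_, fun w => ?_, fun f hf => ?_⟩
  · by_cases h : ∃ a, v.1 = a :: u.1
    · simp only [P, dif_pos h, dif_neg (hasymm _ _ h), SimpleGraph.Walk.reverse_reverse]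
    · simp only [P, dif_neg h, dif_pos (e.resolve_left h)]
  · obtain ⟨-, c, p, huv, -, hsupp, -⟩ := hP e
    rw [← Sym2.mem_iff, huv, Sym2.mem_iff]
    rcases hsupp _ hx with h | h
    · exact Or.inr (Subtype.ext h)
    · exact Or.inl (φ.injective h)
  · obtain ⟨-, c, p, huv, ⟨a, ha⟩, hsupp, -⟩ := hP e
    obtain ⟨-, c', p', huv', ⟨a', ha'⟩, hsupp', -⟩ := hP e'
    have h1 := (hsupp w hw).resolve_right fun h => hφ ⟨p, h.symm⟩
    have h2 := (hsupp' w hw').resolve_right fun h => hφ ⟨p', h.symm⟩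
    have hc : c = c' := Subtype.ext (h1.symm.trans h2)
    have hp : p = p' := by
      rw [← hc, ha] at ha'
      exact Subtype.ext (List.cons.inj ha').2
    rw [huv, huv', hc, hp]
  · by_cases hw : w = root
    · exact Or.inl ⟨⟨[], Nat.zero_le _⟩, hw.symm⟩
    · obtain ⟨u, v, e, h⟩ := hedge w hw
      exact Or.inr ⟨u, v, e, SimpleGraph.Walk.fst_mem_support_of_mem_edges _ h⟩
  · induction f with
    | _ x y =>
      refine adj_cases (P := fun x y => ∃ (u v : Word (d + 1) q)
        (e : (completeTree (d + 1) q).Adj u v), s(x, y) ∈ (P e).edges) hedge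
        (fun w hw => ?_) ((blowupTree d q k).mem_edgeSet.1 hf)
      rw [Sym2.eq_swap]
      exact hedge w hw

/-- Cutting off the leaves lowers the peak by at most one, so it does not matter for the factor
four that the robber only uses the inner vertices of the complete tree. -/
theorem vertexIsoPeak_lt_zeta_blowupTree (hq : 0 < q) :
    vertexIsoPeak (completeTree (d + 1) q) < 4 * (2 * k + 1) * zeta (blowupTree d q k) k := by
  have : Nonempty (Blowup d q k) := ⟨root⟩
  obtain ⟨hpos, hwin⟩ := zeta_mem (blowupTree d q k) k
  by_contra! hle
  have h1 := vertexIsoPeak_completeTree_succ_le d q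
  have h2 : 0 < zeta (blowupTree d q k) k * (2 * k + 1) := by positivity
  have h3 : 4 * (2 * k + 1) * zeta (blowupTree d q k) k =
      4 * (zeta (blowupTree d q k) k * (2 * k + 1)) := by ring
  exact not_copsWin_blowupTree hq hpos (by omega) hwin

theorem peak_div_lt_zeta_blowupTree (hq : 0 < q) :
    (vertexIsoPeak (completeTree (d + 1) q) : ℝ) / (4 * (2 * (k : ℝ) + 1)) <
      (zeta (blowupTree d q k) k : ℝ) := by
  rw [div_lt_iff₀ (by positivity), mul_comm]
  exact_mod_cast vertexIsoPeak_lt_zeta_blowupTree hq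

theorem le_peak_div {h : ℕ} (hh : 2 ≤ h) (hq : 4 ≤ q) (k : ℕ) :
    (3 / 160 : ℝ) * (((h : ℝ) - 2) / (2 * (k : ℝ) + 1)) ≤
      (vertexIsoPeak (completeTree h q) : ℝ) / (4 * (2 * (k : ℝ) + 1)) := by
  have h1 : (3 : ℝ) * ((h : ℝ) - 2) ≤ 40 * vertexIsoPeak (completeTree h q) := by
    have := three_mul_le_vertexIsoPeak (h := h) hq
    have h2 : ((h - 2 : ℕ) : ℝ) = (h : ℝ) - 2 := by push_cast [Nat.cast_sub hh]; ring
    rw [← h2]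
    exact_mod_cast this
  rw [mul_div_assoc', div_le_div_iff₀ (by positivity) (by positivity)]
  nlinarith [show (0 : ℝ) < 2 * (k : ℝ) + 1 by positivity]

/-- The height `d` of the inner complete tree for which the blown-up tree has a radius of about
`(k * w) ^ 2`: the radius is `d * (2 * k + 1) + k`, that is, about `2 * k * d`. -/
noncomputable def chosenHeight (k : ℕ) (w : ℝ) : ℕ := max 2 ⌈(k : ℝ) * w ^ 2 / 2⌉₊

/-- Eventually, the radius divided by `(k * ω) ^ 2` lies between `1` and `1 + 1 / k + 5 / ω ^ 2`. -/
theorem isEquivalent_sqrt_radius {ω : ℕ → ℝ} (hω : Tendsto ω atTop atTop) {k : ℕ → ℕ}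
    (hk : Tendsto k atTop atTop) :
    (fun j => √((chosenHeight (k j) (ω j) * (2 * k j + 1) + k j : ℕ) : ℝ) / k j) ~[atTop] ω := by
  have hk1 : ∀ᶠ j in atTop, 1 ≤ k j := hk.eventually_ge_atTop 1
  have hω2 : ∀ᶠ j in atTop, 2 ≤ ω j := hω.eventually_ge_atTop 2
  have hkR : Tendsto (fun j => (k j : ℝ)⁻¹) atTop (nhds 0) :=
    tendsto_inv_atTop_zero.comp (tendsto_natCast_atTop_atTop.comp hk)
  have hωR : Tendsto (fun j => (ω j)⁻¹) atTop (nhds 0) := tendsto_inv_atTop_zero.comp hω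
  have hsq : Tendsto (fun j => ((chosenHeight (k j) (ω j) * (2 * k j + 1) + k j : ℕ) : ℝ) /
      (k j * ω j) ^ 2) atTop (nhds 1) := by
    have hupper : Tendsto (fun j => 1 + (k j : ℝ)⁻¹ + 5 * (ω j)⁻¹ ^ 2) atTop (nhds 1) := by
      simpa using (hkR.const_add 1).add ((hωR.pow 2).const_mul 5)
    refine tendsto_of_tendsto_of_tendsto_of_le_of_le' tendsto_const_nhds hupper ?_ ?_
    · filter_upwards [hk1, hω2] with j hkj hωj
      have hk0 : (1 : ℝ) ≤ k j := by exact_mod_cast hkj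
      have hh : (k j : ℝ) * ω j ^ 2 / 2 ≤ chosenHeight (k j) (ω j) :=
        (Nat.le_ceil _).trans (by exact_mod_cast le_max_right _ _)
      rw [le_div_iff₀ (by positivity)]
      push_cast
      nlinarith [mul_le_mul_of_nonneg_left hh (by positivity : (0 : ℝ) ≤ 2 * k j)]
    · filter_upwards [hk1, hω2] with j hkj hωj
      have hk0 : (1 : ℝ) ≤ k j := by exact_mod_cast hkj
      have hω0 : (0 : ℝ) < ω j := by linarith
      have hx : (2 : ℝ) ≤ k j * ω j ^ 2 / 2 := by nlinarith
      have hceil : 2 ≤ ⌈(k j : ℝ) * ω j ^ 2 / 2⌉₊ := by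
        have := hx.trans (Nat.le_ceil _)
        exact_mod_cast this
      have hh : (chosenHeight (k j) (ω j) : ℝ) < (k j : ℝ) * ω j ^ 2 / 2 + 1 := by
        rw [chosenHeight, max_eq_right hceil]
        exact Nat.ceil_lt_add_one (by positivity)
      rw [div_le_iff₀ (by positivity)]
      have hexp : (1 + (k j : ℝ)⁻¹ + 5 * (ω j)⁻¹ ^ 2) * (k j * ω j) ^ 2 =
          (k j : ℝ) ^ 2 * ω j ^ 2 + k j * ω j ^ 2 + 5 * (k j : ℝ) ^ 2 := by
        field_simp
      rw [hexp]
      push_cast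
      have h1 := mul_le_mul_of_nonneg_right hh.le (by positivity : (0 : ℝ) ≤ 2 * k j + 1)
      have h2 : (k j : ℝ) ≤ (k j : ℝ) ^ 2 := by nlinarith
      have h3 : 0 ≤ (k j : ℝ) * ω j ^ 2 := by positivity
      nlinarith
  refine (isEquivalent_iff_tendsto_one (hω.eventually_ne_atTop 0)).2 ?_
  have hsqrt := (Real.continuous_sqrt.tendsto 1).comp hsq
  rw [Real.sqrt_one] at hsqrt
  refine hsqrt.congr' ?_
  filter_upwards [hk1, hω2] with j hkj hωj
  have hpos : (0 : ℝ) ≤ k j * ω j := mul_nonneg (Nat.cast_nonneg _) (by linarith)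
  simp only [Function.comp, Pi.div_apply]
  rw [Real.sqrt_div (Nat.cast_nonneg _), Real.sqrt_sq hpos, div_div]

theorem tendsto_zeta_blowupTree {ω : ℕ → ℝ} (hω : Tendsto ω atTop atTop) (k : ℕ → ℕ)
    (hk : ∀ j, 1 ≤ k j) :
    Tendsto (fun j => zeta (blowupTree (chosenHeight (k j) (ω j)) 4 (k j)) (k j)) atTop atTop := by
  rw [← tendsto_natCast_atTop_iff (R := ℝ)]
  have h1 : Tendsto (fun j => (1 / 320 : ℝ) * (ω j) ^ 2 - 1) atTop atTop :=
    tendsto_atTop_add_const_right _ _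
      (((tendsto_pow_atTop two_ne_zero).comp hω).const_mul_atTop (by norm_num))
  refine tendsto_atTop_mono (fun j => ?_) h1
  set h := chosenHeight (k j) (ω j) with hdef
  have hk0 : (1 : ℝ) ≤ k j := by exact_mod_cast hk j
  have hh : (k j : ℝ) * ω j ^ 2 / 2 ≤ h :=
    (Nat.le_ceil _).trans (by exact_mod_cast le_max_right _ _)
  have h2 : 2 ≤ h + 1 := (le_max_left _ _).trans (Nat.le_succ h)
  have h3 := (le_peak_div h2 (le_refl 4) (k j)).trans
    (peak_div_lt_zeta_blowupTree (d := h) (k := k j) (by norm_num : 0 < 4)).le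
  refine le_trans ?_ h3
  push_cast
  rw [mul_div_assoc', le_div_iff₀ (by positivity)]
  nlinarith [mul_nonneg (sub_nonneg.2 hk0) (sq_nonneg (ω j))]

end Conclusion

end VisLoc

theorem mainTheorem6 :
    (∀ h q k : ℕ, 3 ≤ h → 4 ≤ q →
      (∃ (V : Type) (_ : Finite V) (T : SimpleGraph V),
        T.IsTree ∧
        T.radius = ((h * (2 * k + 1) - (k + 1) : ℕ) : ℕ∞) ∧
        (1 ≤ k → VisLoc.IsSubdivision (VisLoc.completeTree h q) T) ∧
        (VisLoc.vertexIsoPeak (VisLoc.completeTree h q) : ℝ) / (4 * (2 * (k : ℝ) + 1)) <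
          (VisLoc.zeta T k : ℝ)) ∧
      (3 / 160 : ℝ) * (((h : ℝ) - 2) / (2 * (k : ℝ) + 1)) ≤
        (VisLoc.vertexIsoPeak (VisLoc.completeTree h q) : ℝ) / (4 * (2 * (k : ℝ) + 1))) ∧
    (∀ ω : ℕ → ℝ, Tendsto ω atTop atTop →
      ∃ (V : ℕ → Type) (_ : ∀ j, Finite (V j)) (T : ∀ j, SimpleGraph (V j))
        (k : ℕ → ℕ) (ω' : ℕ → ℝ),
        (∀ j, (T j).IsTree) ∧
        Tendsto (fun j => (T j).radius.toNat) atTop atTop ∧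
        Tendsto k atTop atTop ∧
        ω' ~[atTop] ω ∧
        (∀ j, (k j : ℝ) = √((T j).radius.toNat : ℝ) / ω' j) ∧
        Tendsto (fun j => VisLoc.zeta (T j) (k j)) atTop atTop) := by
  refine ⟨fun h q k hh hq => ⟨?_, VisLoc.le_peak_div (by omega) hq k⟩, fun ω hω => ?_⟩
  · obtain ⟨d, rfl⟩ : ∃ d, h = d + 1 := ⟨h - 1, by omega⟩
    refine ⟨VisLoc.Blowup d q k, inferInstance, VisLoc.blowupTree d q k, VisLoc.blowupTree_isTree,
      ?_, VisLoc.isSubdivision_blowupTree, VisLoc.peak_div_lt_zeta_blowupTree (by omega)⟩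
    rw [VisLoc.blowupTree_radius (by omega) (by omega), Nat.add_mul d 1]
    congr 1
    omega
  · let k : ℕ → ℕ := fun j => j + 1
    have hk : Tendsto k atTop atTop := tendsto_add_atTop_nat 1
    let R : ℕ → ℕ := fun j => VisLoc.chosenHeight (k j) (ω j) * (2 * k j + 1) + k j
    have hrad : ∀ j, (VisLoc.blowupTree (VisLoc.chosenHeight (k j) (ω j)) 4 (k j)).radius.toNat =
        R j := by
      intro j
      have hpos : 0 < VisLoc.chosenHeight (k j) (ω j) :=
        lt_of_lt_of_le Nat.two_pos (le_max_left _ _)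
      rw [VisLoc.blowupTree_radius hpos (by norm_num), ENat.toNat_natCast]
    refine ⟨fun j => VisLoc.Blowup (VisLoc.chosenHeight (k j) (ω j)) 4 (k j),
      fun j => inferInstance, fun j => VisLoc.blowupTree (VisLoc.chosenHeight (k j) (ω j)) 4 (k j),
      k,
      fun j => √(R j : ℝ) / k j, fun j => VisLoc.blowupTree_isTree, ?_, hk,
      VisLoc.isEquivalent_sqrt_radius hω hk, fun j => ?_,
      VisLoc.tendsto_zeta_blowupTree hω k fun j => Nat.le_add_left 1 j⟩
    · simp only [hrad]
      exact tendsto_atTop_mono (fun j => Nat.le_add_left _ _) hk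
    · have hR : 0 < √(R j : ℝ) := Real.sqrt_pos.2 (by positivity)
      rw [hrad, div_div_cancel₀ hR.ne']
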